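/- Let $d\ge 1$ be an integer and let $q\in\mathbb C\setminus\{0\}$. Let $\mathcal F_n\cong\mathbb Z^n\rtimes B_n$ be the framed braid group on $n$ strands, generated by $\sigma_1,\dots,\sigma_{n-1}$ and $t_1,\dots,t_n$ with the relations $\sigma_i\sigma_j\sigma_i=\sigma_j\sigma_i\sigma_j$ for $|i-j|=1$, $\sigma_i\sigma_j=\sigma_j\sigma_i$ for $|i-j|>1$, $t_it_j=t_jt_i$, and $t_j\sigma_i=\sigma_it_{s_i(j)}$, where $s_i=(i,i+1)$. Let $\mathcal F_{d,n}$ be the quotient of $\mathcal F_n$ by the relations $t_j^d=1$. Put $e_i=\frac1d\sum_{s=1}^{d}t_i^st_{i+1}^{-s}\in\mathbb C\mathcal F_{d,n}$. The Yokonuma--Hecke algebra $\mathrm Y_{d,n}(q)$ is the quotient of $\mathbb C\mathcal F_{d,n}$ by the two-sided ideal generated by the elements $\sigma_i^2-1-(q-q^{-1})e_i\sigma_i$, $1\le i\le n-1$; write $g_i$ for the image of $\sigma_i$. Let $X_D=(\mathrm x_1,\dots,\mathrm x_{d-1})$ be a complex solution of the $\mathrm E$-system $E^{(m)}=\mathrm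 x_mE^{(0)}$ ($1\le m\le d-1$), where $E^{(m)}=\frac1d\sum_{s=0}^{d-1}\mathrm x_{m+s}\mathrm x_{d-s}$, with indices modulo $d$ and $\mathrm x_0=1$ (such solutions are parametrized by the non-empty subsets $D$ of $\mathbb Z/d\mathbb Z$). The specialized trace $\mathrm{tr}_{d,D}$ is the unique linear map from $\bigcup_n\mathrm Y_{d,n}(q)$ to $\mathbb C[z]$ such that, for all $n$, $\mathrm{tr}_{d,D}(ab)=\mathrm{tr}_{d,D}(ba)$ for $a,b\in \mathrm Y_{d,n}(q)$; $\mathrm{tr}_{d,D}(1)=1$; $\mathrm{tr}_{d,D}(ag_n)=z\,\mathrm{tr}_{d,D}(a)$ for $n\ge1$ and $a\in \mathrm Y_{d,n}(q)$; and $\mathrm{tr}_{d,D}(at_{n+1}^s)=\mathrm x_s\,\mathrm{tr}_{d,D}(a)$ for $a\in \mathrm Y_{d,n}(q)$ and $1\le s\le d-1$. For a framed braid $\alpha\in\mathcal F_n$, $\mathrm{tr}_{d,D}(\alpha)$ denotes the trace of the image of $\alpha$ in $\mathrm Y_{d,n}(q)$. For $n,m\ge1$, $\alpha\in\mathcal F_n$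 and $\beta\in\mathcal F_m$, the connected sum $\alpha\#\beta\in\mathcal F_{n+m-1}$ is the product $\alpha^{[0]}\beta^{[n-1]}$, where $\alpha^{[0]}$ is the image of $\alpha$ under $\sigma_i\mapsto\sigma_i$, $t_j\mapsto t_j$, and $\beta^{[n-1]}$ is the image of $\beta$ under $\sigma_i\mapsto\sigma_{n+i-1}$, $t_j\mapsto t_{n+j-1}$. **Proposition.** For all $n,m\ge1$, the following are equivalent: 1. $\mathrm{tr}_{d,D}(\alpha\#\beta)=\mathrm{tr}_{d,D}(\alpha)\,\mathrm{tr}_{d,D}(\beta)$ for all $\alpha\in\mathcal F_n$ and $\beta\in\mathcal F_m$; 2. $\mathrm x_1^d=1$ and $\mathrm x_k=\mathrm x_1^k$ for all $k=1,\dots,d-1$. -/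

import Mathlib

noncomputable section

namespace YokonumaHecke

/-! ### Framed braid groups -/

/-- Generators of the framed braid group on `n` strands, with strands numbered from `0`:
`sigma i` crosses the strands `i` and `i + 1`, and `t j` is the framing `1` on the strand `j`. -/
inductive FramedGen (n : ℕ) : Type
  | sigma (i : ℕ) (hi : i + 1 < n) : FramedGen n
  | t (j : Fin n) : FramedGen n

/-- The generator `sigma i`, in the free group. -/
def freeSigma {n : ℕ} (i : ℕ) (hi : i + 1 < n) : FreeGroup (FramedGen n) :=
  FreeGroup.of (.sigma i hi)

/-- The generator `t j`, in the free group. -/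
def freeT {n : ℕ} (j : Fin n) : FreeGroup (FramedGen n) := FreeGroup.of (.t j)

/-- The transposition `(i, i + 1)` of the strands. -/
def strandSwap {n : ℕ} (i : ℕ) (hi : i + 1 < n) : Equiv.Perm (Fin n) :=
  Equiv.swap ⟨i, Nat.lt_of_succ_lt hi⟩ ⟨i + 1, hi⟩

/-- The defining relations of the framed braid group; `u * v⁻¹` stands for `u = v`. -/
inductive FramedRel (n : ℕ) : FreeGroup (FramedGen n) → Prop
  /-- `σ_i σ_j σ_i = σ_j σ_i σ_j` for `|i - j| = 1` -/
  | braid (i j : ℕ) (hi : i + 1 < n) (hj : j + 1 < n) (hij : j = i + 1 ∨ i = j + 1) :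
      FramedRel n ((freeSigma i hi * freeSigma j hj * freeSigma i hi) *
        (freeSigma j hj * freeSigma i hi * freeSigma j hj)⁻¹)
  /-- `σ_i σ_j = σ_j σ_i` for `|i - j| > 1` -/
  | far (i j : ℕ) (hi : i + 1 < n) (hj : j + 1 < n) (hij : i + 1 < j ∨ j + 1 < i) :
      FramedRel n ((freeSigma i hi * freeSigma j hj) * (freeSigma j hj * freeSigma i hi)⁻¹)
  /-- `t_i t_j = t_j t_i` -/
  | framing (i j : Fin n) : FramedRel n ((freeT i * freeT j) * (freeT j * freeT i)⁻¹)
  /-- `t_j σ_i = σ_i t_{s_i(j)}` -/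
  | mixed (i : ℕ) (hi : i + 1 < n) (j : Fin n) :
      FramedRel n ((freeT j * freeSigma i hi) * (freeSigma i hi * freeT (strandSwap i hi j))⁻¹)

/-- The framed braid group `𝓕_n`. -/
abbrev FramedBraidGroup (n : ℕ) : Type := PresentedGroup {r | FramedRel n r}

/-- The modular framed braid group `𝓕_{d,n}`: the framings are taken modulo `d`. -/
abbrev ModularFramedBraidGroup (d n : ℕ) : Type :=
  PresentedGroup ({r | FramedRel n r} ∪ {r | ∃ j : Fin n, r = freeT j ^ d})

/-- Renumbering of the strands: every strand number is increased by `r`. -/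
def shiftGen {n m : ℕ} (r : ℕ) (h : r + n ≤ m) : FramedGen n → FramedGen m
  | .sigma i hi => .sigma (r + i) (by omega)
  | .t j => .t ⟨r + j, by omega⟩

theorem shiftGen_rel {n m : ℕ} (r : ℕ) (h : r + n ≤ m) {x : FreeGroup (FramedGen n)}
    (hx : FramedRel n x) : FramedRel m (FreeGroup.map (shiftGen r h) x) := by
  cases hx with
  | braid i j hi hj hij =>
    simpa [freeSigma, shiftGen] using
      FramedRel.braid (n := m) (r + i) (r + j) (by omega) (by omega) (by omega)
  | far i j hi hj hij =>
    simpa [freeSigma, shiftGen] using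
      FramedRel.far (n := m) (r + i) (r + j) (by omega) (by omega) (by omega)
  | framing i j =>
    simpa [freeT, shiftGen] using
      FramedRel.framing (n := m) ⟨r + i, by omega⟩ ⟨r + j, by omega⟩
  | mixed i hi j =>
    have key := FramedRel.mixed (n := m) (r + i) (by omega) ⟨r + j, by omega⟩
    have hs : strandSwap (n := m) (r + i) (by omega) ⟨r + j, by omega⟩ =
        ⟨r + (strandSwap i hi j : Fin n), by omega⟩ := by
      obtain ⟨j, hj⟩ := j
      simp only [strandSwap, Equiv.swap_apply_def, Fin.mk.injEq, Nat.add_assoc,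
        Nat.add_left_cancel_iff]
      split_ifs <;> rfl
    rw [hs] at key
    simpa [freeT, freeSigma, shiftGen] using key

/-- The homomorphism `𝓕_n → 𝓕_m`, `σ_i ↦ σ_{r+i}`, `t_j ↦ t_{r+j}`, where `r + n ≤ m`. -/
def FramedBraidGroup.shift {n m : ℕ} (r : ℕ) (h : r + n ≤ m) :
    FramedBraidGroup n →* FramedBraidGroup m :=
  PresentedGroup.toGroup (f := fun g => PresentedGroup.of (shiftGen r h g)) (by
    intro x hx
    have := PresentedGroup.one_of_mem (rels := {r | FramedRel m r}) (shiftGen_rel r h hx)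
    rw [← this, ← MonoidHom.comp_apply]
    refine DFunLike.congr_fun (FreeGroup.ext_hom _ _ fun g => ?_) x
    simp [PresentedGroup.of])

/-- The homomorphism `𝓕_{d,n} → 𝓕_{d,m}`, `σ_i ↦ σ_{r+i}`, `t_j ↦ t_{r+j}`, where `r + n ≤ m`. -/
def ModularFramedBraidGroup.shift (d : ℕ) {n m : ℕ} (r : ℕ) (h : r + n ≤ m) :
    ModularFramedBraidGroup d n →* ModularFramedBraidGroup d m :=
  PresentedGroup.toGroup (f := fun g => PresentedGroup.of (shiftGen r h g)) (by
    intro x hx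
    have hx' : FreeGroup.map (shiftGen r h) x ∈
        ({r | FramedRel m r} ∪ {r | ∃ j : Fin m, r = freeT j ^ d} :
          Set (FreeGroup (FramedGen m))) := by
      rcases hx with hx | ⟨j, rfl⟩
      · exact Or.inl (shiftGen_rel r h hx)
      · exact Or.inr ⟨⟨r + j, by omega⟩, by simp [freeT, shiftGen]⟩
    have := PresentedGroup.one_of_mem hx'
    rw [← this, ← MonoidHom.comp_apply]
    refine DFunLike.congr_fun (FreeGroup.ext_hom _ _ fun g => ?_) x
    simp [PresentedGroup.of])

/-- The connected sum `α # β = α^{[0]} β^{[n-1]}` of framed braids on `n` and `m` strands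
(here `n` and `m` are written as `n + 1` and `m + 1`), a framed braid on `n + m - 1` strands. -/
def connectedSum {n m : ℕ} (α : FramedBraidGroup (n + 1)) (β : FramedBraidGroup (m + 1)) :
    FramedBraidGroup (n + m + 1) :=
  FramedBraidGroup.shift 0 (by omega) α * FramedBraidGroup.shift n (by omega) β

/-- The natural epimorphism `𝓕_n → 𝓕_{d,n}`. -/
def toModular (d n : ℕ) : FramedBraidGroup n →* ModularFramedBraidGroup d n :=
  PresentedGroup.toGroup (f := fun g => PresentedGroup.of g) (by
    intro x hx
    have := PresentedGroup.one_of_mem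
      (rels := {r | FramedRel n r} ∪ {r | ∃ j : Fin n, r = freeT j ^ d}) (Or.inl hx)
    rw [← this]
    refine DFunLike.congr_fun (FreeGroup.ext_hom _ _ fun g => ?_) x
    simp [PresentedGroup.of])

/-! ### Yokonuma--Hecke algebras -/

/-- The braiding generator `σ_i` of `ℂ𝓕_{d,n}`. -/
def algSigma (d : ℕ) {n : ℕ} (i : ℕ) (hi : i + 1 < n) :
    MonoidAlgebra ℂ (ModularFramedBraidGroup d n) :=
  MonoidAlgebra.of ℂ _ (PresentedGroup.of (.sigma i hi))

/-- The framing generator `t_j` as an element of `𝓕_{d,n}`. -/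
def modT (d : ℕ) {n : ℕ} (j : Fin n) : ModularFramedBraidGroup d n :=
  PresentedGroup.of (.t j)

/-- The element `e_i = (1/d) ∑_{1 ≤ s ≤ d} t_i^s t_{i+1}^{-s}` of `ℂ𝓕_{d,n}`. -/
def algE (d : ℕ) {n : ℕ} (i : ℕ) (hi : i + 1 < n) :
    MonoidAlgebra ℂ (ModularFramedBraidGroup d n) :=
  (1 / (d : ℂ)) • ∑ s ∈ Finset.Icc 1 d,
    MonoidAlgebra.of ℂ _
      (modT d ⟨i, Nat.lt_of_succ_lt hi⟩ ^ s * (modT d ⟨i + 1, hi⟩ ^ s)⁻¹)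

/-- The quadratic relations `σ_i² = 1 + (q - q⁻¹) e_i σ_i`. -/
inductive QuadraticRel (d n : ℕ) (q : ℂ) :
    MonoidAlgebra ℂ (ModularFramedBraidGroup d n) →
      MonoidAlgebra ℂ (ModularFramedBraidGroup d n) → Prop
  | quad (i : ℕ) (hi : i + 1 < n) :
      QuadraticRel d n q (algSigma d i hi ^ 2) (1 + (q - q⁻¹) • (algE d i hi * algSigma d i hi))

/-- The Yokonuma--Hecke algebra `Y_{d,n}(q)`: the quotient of `ℂ𝓕_{d,n}` by the two-sided ideal
generated by the quadratic relations. -/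
abbrev YHAlgebra (d n : ℕ) (q : ℂ) : Type := RingQuot (QuadraticRel d n q)

/-- The quotient map `ℂ𝓕_{d,n} → Y_{d,n}(q)`. -/
def toYH (d n : ℕ) (q : ℂ) :
    MonoidAlgebra ℂ (ModularFramedBraidGroup d n) →ₐ[ℂ] YHAlgebra d n q :=
  RingQuot.mkAlgHom ℂ (QuadraticRel d n q)

/-- The image in `Y_{d,n}(q)` of a framed braid, under the natural epimorphism. -/
def braidToYH (d : ℕ) {n : ℕ} (q : ℂ) (α : FramedBraidGroup n) : YHAlgebra d n q :=
  toYH d n q (MonoidAlgebra.of ℂ _ (toModular d n α))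

/-- The generator `g_i` of `Y_{d,n}(q)`. -/
def genG (d : ℕ) {n : ℕ} (q : ℂ) (i : ℕ) (hi : i + 1 < n) : YHAlgebra d n q :=
  toYH d n q (algSigma d i hi)

/-- The generator `t_j` of `Y_{d,n}(q)`. -/
def genT (d : ℕ) {n : ℕ} (q : ℂ) (j : Fin n) : YHAlgebra d n q :=
  toYH d n q (MonoidAlgebra.of ℂ _ (modT d j))

theorem mapDomain_shift_algSigma (d : ℕ) {n m : ℕ} (r : ℕ) (h : r + n ≤ m) (i : ℕ)
    (hi : i + 1 < n) :
    MonoidAlgebra.mapDomainAlgHom ℂ ℂ (ModularFramedBraidGroup.shift d r h) (algSigma d i hi)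
      = algSigma d (r + i) (by omega) := by
  simp [algSigma, ModularFramedBraidGroup.shift, shiftGen]

theorem mapDomain_shift_algE (d : ℕ) {n m : ℕ} (r : ℕ) (h : r + n ≤ m) (i : ℕ)
    (hi : i + 1 < n) :
    MonoidAlgebra.mapDomainAlgHom ℂ ℂ (ModularFramedBraidGroup.shift d r h) (algE d i hi)
      = algE d (r + i) (by omega) := by
  simp [algE, modT, ModularFramedBraidGroup.shift, shiftGen, add_assoc]

/-- The natural inclusion `Y_{d,n}(q) → Y_{d,n+1}(q)`, `g_i ↦ g_i`, `t_j ↦ t_j`. -/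
def incl (d n : ℕ) (q : ℂ) : YHAlgebra d n q →ₐ[ℂ] YHAlgebra d (n + 1) q :=
  RingQuot.liftAlgHom ℂ ⟨(toYH d (n + 1) q).comp
    (MonoidAlgebra.mapDomainAlgHom ℂ ℂ (ModularFramedBraidGroup.shift d 0 (by omega))), by
      rintro _ _ ⟨i, hi⟩
      simp only [AlgHom.comp_apply, map_pow, map_add, map_one, map_smul, map_mul,
        mapDomain_shift_algSigma, mapDomain_shift_algE]
      have := RingQuot.mkAlgHom_rel ℂ
        (QuadraticRel.quad (d := d) (n := n + 1) (q := q) (0 + i) (by omega))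
      simpa only [toYH, map_pow, map_add, map_one, map_smul, map_mul] using this⟩

/-! ### The traces -/

/-- `x` is a solution of the `E`-system: with indices modulo `d` and `x₀ = 1`,
`E^{(m)} = x_m E^{(0)}` for `1 ≤ m ≤ d - 1`, where
`E^{(m)} = (1/d) ∑_{s=0}^{d-1} x_{m+s} x_{d-s}`. -/
def IsESystemSolution (d : ℕ) [NeZero d] (x : ZMod d → ℂ) : Prop :=
  x 0 = 1 ∧ ∀ m : ℕ, 1 ≤ m → m ≤ d - 1 →
    (1 / (d : ℂ)) * ∑ s ∈ Finset.range d, x ((m : ZMod d) + s) * x ((d : ZMod d) - s) =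
      x m * ((1 / (d : ℂ)) * ∑ s ∈ Finset.range d, x s * x ((d : ZMod d) - s))

/-- The rules of the Markov trace on `⋃ₙ Y_{d,n}(q)` with values in `ℂ[z]` and parameters
`x₁, …, x_{d-1}`. A linear map on the union is a family of linear maps that is compatible with
the inclusions. -/
structure IsMarkovTrace (d : ℕ) (q : ℂ) (x : ZMod d → ℂ)
    (tr : ∀ n : ℕ, YHAlgebra d n q →ₗ[ℂ] Polynomial ℂ) : Prop where
  compat : ∀ (n : ℕ) (a : YHAlgebra d n q), tr (n + 1) (incl d n q a) = tr n a
  comm : ∀ (n : ℕ) (a b : YHAlgebra d n q), tr n (a * b) = tr n (b * a)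
  one : ∀ n : ℕ, tr n 1 = 1
  markov : ∀ (n : ℕ) (a : YHAlgebra d (n + 1) q),
    tr (n + 2) (incl d (n + 1) q a * genG d q n (by omega)) = Polynomial.X * tr (n + 1) a
  framing : ∀ (n : ℕ) (a : YHAlgebra d n q) (s : ℕ), 1 ≤ s → s ≤ d - 1 →
    tr (n + 1) (incl d n q a * genT d q (Fin.last n) ^ s) = Polynomial.C (x s) * tr n a

/-! ### Existence of the Markov trace

What follows proves that a family satisfying the rules exists. All the algebras act on
one module of functions on framed permutations of `ℕ`, as in the regular representation; the trace
is the coefficient of the identity of a product with Jucys--Murphy type operators. -/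

/-- Framed permutations of `ℕ`. -/
abbrev Conf (d : ℕ) : Type := (ℕ → ZMod d) × Equiv.Perm ℕ

section Model

variable {d : ℕ} [NeZero d] {A : Type} [CommRing A]

abbrev Mod (d : ℕ) (A : Type) : Type := Conf d → A

def opS (π : Equiv.Perm ℕ) : Module.End A (Mod d A) where
  toFun f := fun p => f (p.1 ∘ π, p.2 * π)
  map_add' _ _ := rfl
  map_smul' _ _ := rfl

def opT (j : ℕ) (s : ZMod d) : Module.End A (Mod d A) where
  toFun f := fun p => f (p.1 + Pi.single j s, p.2)
  map_add' _ _ := rfl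
  map_smul' _ _ := rfl

def opD (i j : ℕ) : Module.End A (Mod d A) where
  toFun f := fun p => if p.2 j < p.2 i then f p else 0
  map_add' f g := by ext p; simp only [Pi.add_apply]; split_ifs <;> simp
  map_smul' a f := by ext p; simp

def opE (κ : A) (i j : ℕ) : Module.End A (Mod d A) :=
  κ • ∑ s : ZMod d, opT i s * opT j (-s)

def opU (κ : A) (i j : ℕ) : Module.End A (Mod d A) := opE κ i j * opD i j

def opG (c κ : A) (i : ℕ) : Module.End A (Mod d A) :=
  opS (Equiv.swap i (i + 1)) + c • opU κ i (i + 1)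

theorem opS_mul (π ρ : Equiv.Perm ℕ) : (opS π * opS ρ : Module.End A (Mod d A)) = opS (π * ρ) := rfl

theorem opS_one : (opS 1 : Module.End A (Mod d A)) = 1 := rfl

theorem opT_mul (j : ℕ) (s r : ZMod d) :
    (opT j s * opT j r : Module.End A (Mod d A)) = opT j (s + r) := by
  ext f p
  change f (p.1 + Pi.single j s + Pi.single j r, p.2) = f (p.1 + Pi.single j (s + r), p.2)
  rw [Pi.single_add, add_assoc]

theorem opT_zero (j : ℕ) : (opT j (0 : ZMod d) : Module.End A (Mod d A)) = 1 := by
  ext f p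
  change f (p.1 + Pi.single j 0, p.2) = f p
  simp

theorem opT_comm (i j : ℕ) (s r : ZMod d) :
    (opT i s * opT j r : Module.End A (Mod d A)) = opT j r * opT i s := by
  ext f p
  change f (p.1 + Pi.single i s + Pi.single j r, p.2) = f (p.1 + Pi.single j r + Pi.single i s, p.2)
  rw [add_right_comm]

theorem opT_pow (j : ℕ) (s : ZMod d) (k : ℕ) :
    (opT j s ^ k : Module.End A (Mod d A)) = opT j ((k : ZMod d) * s) := by
  induction k with
  | zero => simp [opT_zero]
  | succ k ih => rw [pow_succ, ih, opT_mul]; congr 1; push_cast; ring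

theorem opS_opT (π : Equiv.Perm ℕ) (j : ℕ) (s : ZMod d) :
    (opS π * opT j s : Module.End A (Mod d A)) = opT (π j) s * opS π := by
  ext f p
  change f (p.1 ∘ π + Pi.single j s, p.2 * π) = f ((p.1 + Pi.single (π j) s) ∘ π, p.2 * π)
  congr 2
  ext i
  by_cases h : i = j
  · subst h; simp
  · simp [h]

theorem opS_opD (π : Equiv.Perm ℕ) (i j : ℕ) :
    (opS π * opD i j : Module.End A (Mod d A)) = opD (π i) (π j) * opS π := rfl

theorem opT_opD (k : ℕ) (s : ZMod d) (i j : ℕ) :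
    (opT k s * opD i j : Module.End A (Mod d A)) = opD i j * opT k s := rfl

theorem opD_comm (i j k l : ℕ) :
    (opD i j * opD k l : Module.End A (Mod d A)) = opD k l * opD i j := by
  ext f p
  simp only [Module.End.mul_apply, opD, LinearMap.coe_mk, AddHom.coe_mk]
  split_ifs <;> rfl

variable (c κ : A)

theorem opT_opE (k : ℕ) (s : ZMod d) (i j : ℕ) :
    (opT k s * opE κ i j : Module.End A (Mod d A)) = opE κ i j * opT k s := by
  simp only [opE, mul_smul_comm, smul_mul_assoc, Finset.mul_sum, Finset.sum_mul]
  congr 1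
  refine Finset.sum_congr rfl fun r _ => ?_
  rw [← mul_assoc, opT_comm k, mul_assoc, opT_comm k, mul_assoc]

theorem opE_comm (i j k l : ℕ) :
    (opE κ i j * opE κ k l : Module.End A (Mod d A)) = opE κ k l * opE κ i j := by
  conv_lhs => rw [opE.eq_1 κ i j]
  conv_rhs => rw [opE.eq_1 κ i j]
  simp only [mul_smul_comm, smul_mul_assoc, Finset.mul_sum, Finset.sum_mul]
  congr 1
  refine Finset.sum_congr rfl fun r _ => ?_
  rw [mul_assoc, opT_opE, ← mul_assoc, opT_opE, mul_assoc]

theorem opE_opD (i j k l : ℕ) :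
    (opE κ i j * opD k l : Module.End A (Mod d A)) = opD k l * opE κ i j := by
  simp only [opE, mul_smul_comm, smul_mul_assoc, Finset.mul_sum, Finset.sum_mul]
  rfl

theorem opS_opE (π : Equiv.Perm ℕ) (i j : ℕ) :
    (opS π * opE κ i j : Module.End A (Mod d A)) = opE κ (π i) (π j) * opS π := by
  simp only [opE, mul_smul_comm, smul_mul_assoc, Finset.mul_sum, Finset.sum_mul]
  congr 1
  refine Finset.sum_congr rfl fun r _ => ?_
  rw [← mul_assoc, opS_opT, mul_assoc, opS_opT, mul_assoc]

theorem opS_opU (π : Equiv.Perm ℕ) (i j : ℕ) :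
    (opS π * opU κ i j : Module.End A (Mod d A)) = opU κ (π i) (π j) * opS π := by
  rw [opU, opU, ← mul_assoc, opS_opE, mul_assoc, opS_opD, mul_assoc]

/-- `E` identifies the two framings it averages over. -/
theorem opE_opT (i j : ℕ) (s : ZMod d) :
    (opE κ i j * opT i s : Module.End A (Mod d A)) = opE κ i j * opT j s := by
  simp only [opE, smul_mul_assoc, Finset.sum_mul]
  congr 1
  refine Fintype.sum_equiv (Equiv.addRight s) _ _ fun r => ?_
  rw [mul_assoc, opT_comm j, ← mul_assoc, opT_mul, mul_assoc, opT_mul]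
  simp

theorem opE_symm (i j : ℕ) : (opE κ i j : Module.End A (Mod d A)) = opE κ j i := by
  rw [opE, opE]
  congr 1
  refine Fintype.sum_equiv (Equiv.neg _) _ _ fun r => ?_
  rw [opT_comm]; simp

theorem opE_mul_left (a b e : ℕ) :
    (opE κ a b * opE κ b e : Module.End A (Mod d A)) = opE κ a b * opE κ a e := by
  rw [opE.eq_1 κ b, opE.eq_1 κ a e]
  simp only [mul_smul_comm, Finset.mul_sum]
  congr 1
  refine Finset.sum_congr rfl fun r _ => ?_
  rw [← mul_assoc, ← mul_assoc, opE_opT]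

theorem opE_mul_right (a b e : ℕ) :
    (opE κ a b * opE κ b e : Module.End A (Mod d A)) = opE κ a e * opE κ b e := by
  rw [opE_comm, opE_symm κ b e, opE_symm κ a b, opE_mul_left, opE_comm, opE_symm κ e a]

variable {κ}

theorem opE_idem (hκ : κ * d = 1) (i j : ℕ) :
    (opE κ i j * opE κ i j : Module.End A (Mod d A)) = opE κ i j := by
  have key : ∀ r : ZMod d, (opE κ i j * (opT i r * opT j (-r)) : Module.End A (Mod d A))
      = opE κ i j := fun r => by
    rw [← mul_assoc, opE_opT, mul_assoc, opT_mul, add_neg_cancel, opT_zero, mul_one]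
  conv_lhs => rw [opE.eq_1 κ i j]; simp only [mul_smul_comm, Finset.mul_sum]
  rw [← opE.eq_1 κ i j]
  simp only [key, Finset.sum_const, Finset.card_univ, ZMod.card]
  rw [← Nat.cast_smul_eq_nsmul A, smul_smul, hκ, one_smul]

theorem opU_comm (i j k l : ℕ) :
    (opU κ i j * opU κ k l : Module.End A (Mod d A)) = opU κ k l * opU κ i j := by
  simp only [opU]
  rw [mul_assoc, ← mul_assoc (opD i j), ← opE_opD, mul_assoc, ← mul_assoc, opE_comm, opD_comm i j,
    mul_assoc, ← mul_assoc (opE κ i j), opE_opD, mul_assoc, ← mul_assoc]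

theorem opU_mul (i j k l : ℕ) :
    (opU κ i j * opU κ k l : Module.End A (Mod d A))
      = (opE κ i j * opE κ k l) * (opD i j * opD k l) := by
  simp only [opU]
  rw [mul_assoc, ← mul_assoc (opD i j), ← opE_opD, mul_assoc, ← mul_assoc]

theorem opU_idem (hκ : κ * d = 1) (i j : ℕ) :
    (opU κ i j * opU κ i j : Module.End A (Mod d A)) = opU κ i j := by
  rw [opU_mul, opE_idem hκ, opU]
  congr 1
  ext f p
  simp only [Module.End.mul_apply, opD, LinearMap.coe_mk, AddHom.coe_mk]
  split_ifs <;> rfl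

theorem opD_rel (a b e : ℕ) (hab : a ≠ b) :
    (opD a b * opD b e + opD a e * opD b a : Module.End A (Mod d A)) = opD a e * opD b e := by
  ext f p
  simp only [Module.End.mul_apply, opD, LinearMap.coe_mk, AddHom.coe_mk, LinearMap.add_apply,
    Pi.add_apply]
  have h : p.2 a ≠ p.2 b := fun h => hab (p.2.injective h)
  split_ifs <;> first | omega | simp

theorem opD_rel' (a b e : ℕ) (hbe : b ≠ e) :
    (opD a b * opD b e + opD a e * opD e b : Module.End A (Mod d A)) = opD a b * opD a e := by
  ext f p
  simp only [Module.End.mul_apply, opD, LinearMap.coe_mk, AddHom.coe_mk, LinearMap.add_apply,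
    Pi.add_apply]
  have h : p.2 b ≠ p.2 e := fun h => hbe (p.2.injective h)
  split_ifs <;> first | omega | simp

theorem opU_rel (a b e : ℕ) (hab : a ≠ b) :
    (opU κ a b * opU κ b e + opU κ a e * opU κ b a : Module.End A (Mod d A))
      = opU κ a e * opU κ b e := by
  rw [opU_mul, opU_mul, opU_mul, ← opD_rel a b e hab, mul_add, opE_mul_right,
    ← opE_mul_right κ a b e, opE_mul_left, opE_symm κ b a, opE_comm κ a e a b]

theorem opU_rel' (a b e : ℕ) (hbe : b ≠ e) :
    (opU κ a b * opU κ b e + opU κ a e * opU κ e b : Module.End A (Mod d A))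
      = opU κ a b * opU κ a e := by
  rw [opU_mul, opU_mul, opU_mul, ← opD_rel' a b e hbe, mul_add, opE_mul_left,
    opE_mul_left, opE_comm κ a e]

theorem opU_symm_add (a b : ℕ) (h : a ≠ b) :
    (opU κ a b + opU κ b a : Module.End A (Mod d A)) = opE κ a b := by
  rw [opU, opU, opE_symm κ b a, ← mul_add]
  conv_rhs => rw [← mul_one (opE κ a b)]
  congr 1
  ext f p
  have h : p.2 a ≠ p.2 b := fun h' => h (p.2.injective h')
  simp only [opD, LinearMap.coe_mk, AddHom.coe_mk, LinearMap.add_apply,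
    Pi.add_apply, Module.End.one_apply]
  split_ifs <;> first | omega | simp

variable (κ)

theorem opG_opT (i j : ℕ) (s : ZMod d) :
    (opG c κ i * opT j s : Module.End A (Mod d A))
      = opT (Equiv.swap i (i + 1) j) s * opG c κ i := by
  have key : (opU κ i (i + 1) * opT j s : Module.End A (Mod d A))
      = opT (Equiv.swap i (i + 1) j) s * opU κ i (i + 1) := by
    have h1 : (opU κ i (i + 1) * opT j s : Module.End A (Mod d A))
      = opE κ i (i + 1) * opT j s * opD i (i + 1) := by
      rw [opU, mul_assoc, ← opT_opD, mul_assoc]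
    have h2 : (opT (Equiv.swap i (i + 1) j) s * opU κ i (i + 1) : Module.End A (Mod d A))
      = opE κ i (i + 1) * opT (Equiv.swap i (i + 1) j) s * opD i (i + 1) := by
      rw [opU, ← mul_assoc, opT_opE]
    rw [h1, h2]
    congr 1
    by_cases hi : j = i
    · subst hi; rw [Equiv.swap_apply_left, opE_opT]
    by_cases hi' : j = i + 1
    · subst hi'; rw [Equiv.swap_apply_right, opE_opT]
    rw [Equiv.swap_apply_of_ne_of_ne hi hi']
  rw [opG, add_mul, mul_add, opS_opT, smul_mul_assoc, mul_smul_comm, key]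

theorem opE_opG (i j : ℕ) (k : ℕ) :
    (opG c κ k * opE κ i j : Module.End A (Mod d A))
      = opE κ (Equiv.swap k (k + 1) i) (Equiv.swap k (k + 1) j) * opG c κ k := by
  simp only [opE, mul_smul_comm, smul_mul_assoc, Finset.mul_sum, Finset.sum_mul]
  congr 1
  refine Finset.sum_congr rfl fun r _ => ?_
  rw [← mul_assoc, opG_opT, mul_assoc, opG_opT, mul_assoc]

theorem opG_far (i j : ℕ) (h : i + 1 < j) :
    (opG c κ i * opG c κ j : Module.End A (Mod d A)) = opG c κ j * opG c κ i := by
  have h1 : (opS (Equiv.swap i (i + 1)) * opU κ j (j + 1) : Module.End A (Mod d A))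
      = opU κ j (j + 1) * opS (Equiv.swap i (i + 1)) := by
    rw [opS_opU, Equiv.swap_apply_of_ne_of_ne, Equiv.swap_apply_of_ne_of_ne] <;> omega
  have h2 : (opS (Equiv.swap j (j + 1)) * opU κ i (i + 1) : Module.End A (Mod d A))
      = opU κ i (i + 1) * opS (Equiv.swap j (j + 1)) := by
    rw [opS_opU, Equiv.swap_apply_of_ne_of_ne, Equiv.swap_apply_of_ne_of_ne] <;> omega
  have h3 : (opS (Equiv.swap i (i + 1)) * opS (Equiv.swap j (j + 1)) : Module.End A (Mod d A))
      = opS (Equiv.swap j (j + 1)) * opS (Equiv.swap i (i + 1)) := by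
    rw [opS_mul, opS_mul]
    congr 1
    refine (Equiv.Perm.Disjoint.commute ?_).eq
    intro x
    by_cases hx : x = i ∨ x = i + 1
    · right; apply Equiv.swap_apply_of_ne_of_ne <;> omega
    · left; apply Equiv.swap_apply_of_ne_of_ne <;> omega
  simp only [opG, add_mul, mul_add, smul_mul_assoc, mul_smul_comm]
  rw [h1, h2, h3, opU_comm i]
  module

variable {κ}

theorem opG_sq (hκ : κ * d = 1) (i : ℕ) :
    (opG c κ i * opG c κ i : Module.End A (Mod d A))
      = 1 + c • (opE κ i (i + 1) * opG c κ i) := by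
  have h1 : (opS (Equiv.swap i (i + 1)) * opU κ i (i + 1) : Module.End A (Mod d A))
      = opU κ (i + 1) i * opS (Equiv.swap i (i + 1)) := by
    rw [opS_opU, Equiv.swap_apply_left, Equiv.swap_apply_right]
  have h3 : (opS (Equiv.swap i (i + 1)) * opS (Equiv.swap i (i + 1)) : Module.End A (Mod d A))
      = 1 := by
    rw [opS_mul, Equiv.swap_mul_self, opS_one]
  have h4 : (opE κ i (i + 1) * opU κ i (i + 1) : Module.End A (Mod d A)) = opU κ i (i + 1) := by
    rw [opU, ← mul_assoc, opE_idem hκ]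
  simp only [opG, add_mul, mul_add, smul_mul_assoc, mul_smul_comm, h4]
  rw [h1, h3, opU_idem hκ, ← opU_symm_add i (i + 1) (by omega), add_mul]
  module

theorem opG_braid (hκ : κ * d = 1) (i : ℕ) :
    (opG c κ i * opG c κ (i + 1) * opG c κ i : Module.End A (Mod d A))
      = opG c κ (i + 1) * opG c κ i * opG c κ (i + 1) := by
  set s := Equiv.swap i (i + 1) with hs
  set r := Equiv.swap (i + 1) (i + 1 + 1) with hr
  have s0 : s i = i + 1 := Equiv.swap_apply_left _ _
  have s1 : s (i + 1) = i := Equiv.swap_apply_right _ _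
  have s2 : s (i + 1 + 1) = i + 1 + 1 := Equiv.swap_apply_of_ne_of_ne (by omega) (by omega)
  have r0 : r i = i := Equiv.swap_apply_of_ne_of_ne (by omega) (by omega)
  have r1 : r (i + 1) = i + 1 + 1 := Equiv.swap_apply_left _ _
  have r2 : r (i + 1 + 1) = i + 1 := Equiv.swap_apply_right _ _
  have ss : s * s = 1 := Equiv.swap_mul_self _ _
  have rr : r * r = 1 := Equiv.swap_mul_self _ _
  have br : s * r * s = r * s * r := by
    ext x
    simp only [Equiv.Perm.mul_apply]
    by_cases h0 : x = i
    · subst h0; simp only [s0, s1, s2, r0, r1, r2]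
    by_cases h1 : x = i + 1
    · subst h1; simp only [s0, s1, s2, r0, r1, r2]
    by_cases h2 : x = i + 1 + 1
    · subst h2; simp only [s0, s1, s2, r0, r1, r2]
    have hs : s x = x := Equiv.swap_apply_of_ne_of_ne h0 h1
    have hr : r x = x := Equiv.swap_apply_of_ne_of_ne h1 h2
    simp only [hs, hr]
  have H1 := opU_rel (d := d) (A := A) (κ := κ) i (i + 1) (i + 1 + 1) (by omega)
  have H2 := opU_rel' (d := d) (A := A) (κ := κ) i (i + 1) (i + 1 + 1) (by omega)
  have key : ∀ (u v : Module.End A (Mod d A)) (π : Equiv.Perm ℕ) (a b : ℕ),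
      u * opS π * opU κ a b = u * opU κ (π a) (π b) * opS π := fun u v π a b => by
    rw [mul_assoc, opS_opU, ← mul_assoc]
  simp only [opG, ← hs, ← hr]
  generalize hj : i + 1 = j at *
  generalize hk : j + 1 = k at *
  have b1 : (opS s * opS r * opS s : Module.End A (Mod d A)) = opS r * opS s * opS r := by
    simp only [opS_mul, br]
  have b2 : (opS s * opS s : Module.End A (Mod d A)) = 1 := by rw [opS_mul, ss, opS_one]
  have b3 : (opS r * opS r : Module.End A (Mod d A)) = 1 := by rw [opS_mul, rr, opS_one]
  have m1 : (opS s * opU κ i j : Module.End A (Mod d A)) = opU κ j i * opS s := by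
    rw [opS_opU, s0, s1]
  have m2 : (opS s * opU κ j k : Module.End A (Mod d A)) = opU κ i k * opS s := by
    rw [opS_opU, s1, s2]
  have m3 : (opS r * opU κ i j : Module.End A (Mod d A)) = opU κ i k * opS r := by
    rw [opS_opU, r0, r1]
  have m4 : (opS r * opU κ j k : Module.End A (Mod d A)) = opU κ k j * opS r := by
    rw [opS_opU, r1, r2]
  have m5 : (opS s * opU κ i k : Module.End A (Mod d A)) = opU κ j k * opS s := by
    rw [opS_opU, s0, s2]
  have m6 : (opS r * opU κ i k : Module.End A (Mod d A)) = opU κ i j * opS r := by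
    rw [opS_opU, r0, r2]
  have i1 := opU_idem (d := d) (A := A) hκ i j
  have i2 := opU_idem (d := d) (A := A) hκ j k
  have c1 := opU_comm (d := d) (A := A) (κ := κ) i j j k
  have c2 := opU_comm (d := d) (A := A) (κ := κ) i j i k
  have c3 := opU_comm (d := d) (A := A) (κ := κ) i k j k
  generalize (opU κ i j : Module.End A (Mod d A)) = u at *
  generalize (opU κ j k : Module.End A (Mod d A)) = v at *
  generalize (opU κ i k : Module.End A (Mod d A)) = w at *
  generalize (opU κ j i : Module.End A (Mod d A)) = u' at *
  generalize (opU κ k j : Module.End A (Mod d A)) = v' at *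
  generalize (opS s : Module.End A (Mod d A)) = S at *
  generalize (opS r : Module.End A (Mod d A)) = R at *
  have e1 : u * S * u = u * u' * S := by rw [mul_assoc, m1, mul_assoc]
  have L : (S + c • u) * (R + c • v) * (S + c • u)
      = S * R * S + c • (S * R * u) + c • (S * v * S) + c • (u * R * S)
        + (c * c) • (S * v * u) + (c * c) • (u * R * u) + (c * c) • (u * v * S)
        + (c * c * c) • (u * v * u) := by
    simp only [add_mul, mul_add, smul_mul_assoc, mul_smul_comm, smul_smul, smul_add, mul_assoc]
    abel
  have L' : (R + c • v) * (S + c • u) * (R + c • v)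
      = R * S * R + c • (R * S * v) + c • (R * u * R) + c • (v * S * R)
        + (c * c) • (R * u * v) + (c * c) • (v * S * v) + (c * c) • (v * u * R)
        + (c * c * c) • (v * u * v) := by
    simp only [add_mul, mul_add, smul_mul_assoc, mul_smul_comm, smul_smul, smul_add, mul_assoc]
    abel
  rw [L, L']
  have t1 : S * R * u = v * S * R := by rw [mul_assoc, m3, ← mul_assoc, m5, mul_assoc]
  have t2 : R * S * v = u * R * S := by rw [mul_assoc, m2, ← mul_assoc, m6, mul_assoc]
  have t3 : S * v * S = w := by rw [m2, mul_assoc, b2, mul_one]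
  have t4 : R * u * R = w := by rw [m3, mul_assoc, b3, mul_one]
  have t5 : S * v * u = w * u' * S := by rw [m2, mul_assoc, m1, mul_assoc]
  have t6 : R * u * v = w * v' * R := by rw [m3, mul_assoc, m4, mul_assoc]
  have t7 : u * R * u = u * w * R := by rw [mul_assoc, m3, mul_assoc]
  have t8 : v * S * v = w * v * S := by rw [mul_assoc, m2, c3, mul_assoc]
  have t9 : u * v * u = v * u * v := by
    rw [c1, mul_assoc, i1, mul_assoc, c1, ← mul_assoc, i2]
  rw [b1, t1, t2, t3, t4, t5, t6, t7, t8, t9, ← H1, ← H2, c1]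
  simp only [add_mul]
  module

variable (κ)

/-- Framing operators acting on the right of the regular representation. -/
def opT' (j : ℕ) (s : ZMod d) : Module.End A (Mod d A) where
  toFun f := fun p => f (p.1 + Pi.single (p.2⁻¹ j) s, p.2)
  map_add' _ _ := rfl
  map_smul' _ _ := rfl

/-- Braid operators acting on the right of the regular representation. -/
def opG' (j : ℕ) : Module.End A (Mod d A) where
  toFun f := fun p => f (p.1, Equiv.swap j (j + 1) * p.2) +
    c * (if p.2⁻¹ (j + 1) < p.2⁻¹ j then opE κ (p.2⁻¹ j) (p.2⁻¹ (j + 1)) f p else 0)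
  map_add' f g := by
    ext p; simp only [Pi.add_apply, map_add]; split_ifs <;> ring
  map_smul' a f := by
    ext p; simp only [Pi.smul_apply, map_smul, smul_eq_mul, RingHom.id_apply]; split_ifs <;> ring

theorem opG_apply (i : ℕ) (f : Mod d A) (k : ℕ → ZMod d) (a : Equiv.Perm ℕ) :
    opG c κ i f (k, a) = f (k ∘ Equiv.swap i (i + 1), a * Equiv.swap i (i + 1)) +
      c * (if a (i + 1) < a i then opE κ i (i + 1) f (k, a) else 0) := by
  simp only [opG, opU, ← opE_opD]
  rw [opE_opD]
  rfl

theorem opG'_apply (j : ℕ) (f : Mod d A) (k : ℕ → ZMod d) (a : Equiv.Perm ℕ) :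
    opG' c κ j f (k, a) = f (k, Equiv.swap j (j + 1) * a) +
    c * (if a⁻¹ (j + 1) < a⁻¹ j then opE κ (a⁻¹ j) (a⁻¹ (j + 1)) f (k, a) else 0) := rfl

theorem opE_apply (i j : ℕ) (f : Mod d A) (k : ℕ → ZMod d) (a : Equiv.Perm ℕ) :
    opE κ i j f (k, a) = κ * ∑ s : ZMod d, f (k + Pi.single i s + Pi.single j (-s), a) := by
  simp only [opE, LinearMap.smul_apply, LinearMap.sum_apply, Pi.smul_apply, Finset.sum_apply,
    smul_eq_mul]
  rfl

theorem opT_opT' (i j : ℕ) (s r : ZMod d) :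
    (opT i s * opT' j r : Module.End A (Mod d A)) = opT' j r * opT i s := by
  ext f ⟨k, a⟩
  change f (k + Pi.single i s + Pi.single (a⁻¹ j) r, a) =
    f (k + Pi.single (a⁻¹ j) r + Pi.single i s, a)
  rw [add_right_comm]

theorem opE_opT' (i j l : ℕ) (s : ZMod d) :
    (opE κ i j * opT' l s : Module.End A (Mod d A)) = opT' l s * opE κ i j := by
  simp only [opE, mul_smul_comm, smul_mul_assoc, Finset.mul_sum, Finset.sum_mul]
  congr 1
  refine Finset.sum_congr rfl fun r _ => ?_
  rw [mul_assoc, opT_opT', ← mul_assoc, opT_opT', mul_assoc]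

theorem opG_opT' (i j : ℕ) (s : ZMod d) :
    (opG c κ i * opT' j s : Module.End A (Mod d A)) = opT' j s * opG c κ i := by
  have h1 : (opS (Equiv.swap i (i + 1)) * opT' j s : Module.End A (Mod d A))
      = opT' j s * opS (Equiv.swap i (i + 1)) := by
    ext f ⟨k, a⟩
    change f (k ∘ Equiv.swap i (i + 1) + Pi.single ((a * Equiv.swap i (i + 1))⁻¹ j) s, _) =
      f ((k + Pi.single (a⁻¹ j) s) ∘ Equiv.swap i (i + 1), _)
    congr 2
    ext l
    simp only [Pi.add_apply, Function.comp_apply, Pi.single_apply, mul_inv_rev, Equiv.swap_inv,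
      Equiv.Perm.mul_apply]
    congr 2
    rw [eq_iff_iff]
    constructor
    · rintro rfl; simp
    · intro h; rw [← h]; simp
  have h2 : (opD i (i + 1) * opT' j s : Module.End A (Mod d A)) = opT' j s * opD i (i + 1) := rfl
  rw [opG, add_mul, mul_add, h1, opU, smul_mul_assoc, mul_smul_comm, mul_assoc, h2, ← mul_assoc,
    opE_opT', mul_assoc]

theorem opT_opG' (i j : ℕ) (s : ZMod d) :
    (opT i s * opG' c κ j : Module.End A (Mod d A)) = opG' c κ j * opT i s := by
  ext f ⟨k, a⟩
  change opG' c κ j f (k + Pi.single i s, a) = opG' c κ j (opT i s f) (k, a)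
  rw [opG'_apply, opG'_apply]
  have := congrArg (fun h : Module.End A (Mod d A) => h f (k, a))
    (opT_opE κ i s (a⁻¹ j) (a⁻¹ (j + 1)))
  change opE κ _ _ f (k + Pi.single i s, a) = opE κ _ _ (opT i s f) (k, a) at this
  rw [this]
  rfl

theorem opE_opG' (i i' j : ℕ) :
    (opE κ i i' * opG' c κ j : Module.End A (Mod d A)) = opG' c κ j * opE κ i i' := by
  simp only [opE, mul_smul_comm, smul_mul_assoc, Finset.mul_sum, Finset.sum_mul]
  congr 1
  refine Finset.sum_congr rfl fun r _ => ?_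
  rw [mul_assoc, opT_opG', ← mul_assoc, opT_opG', mul_assoc]

/-- Averaging over two framings absorbs their transposition. -/
theorem opE_swap (i j : ℕ) (f : Mod d A) (k : ℕ → ZMod d) (a : Equiv.Perm ℕ) (hij : i ≠ j) :
    opE κ i j f (k ∘ Equiv.swap i j, a) = opE κ i j f (k, a) := by
  rw [opE_apply, opE_apply]
  congr 1
  refine Fintype.sum_equiv (Equiv.addRight (k j - k i)) _ _ fun s => ?_
  congr 2
  ext l
  by_cases h1 : l = i
  · subst h1; simp [hij]; ring
  by_cases h2 : l = j
  · subst h2; simp [h1]; ring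
  simp [h1, h2, Equiv.swap_apply_of_ne_of_ne]

theorem opG_opG' (i j : ℕ) :
    (opG c κ i * opG' c κ j : Module.End A (Mod d A)) = opG' c κ j * opG c κ i := by
  ext f ⟨k, a⟩
  simp only [Module.End.mul_apply]
  rw [opG_apply, opG'_apply]
  have e1 : opE κ i (i + 1) (opG' c κ j f) (k, a) = opG' c κ j (opE κ i (i + 1) f) (k, a) :=
    congrArg (fun h : Module.End A (Mod d A) => h f (k, a)) (opE_opG' c κ i (i + 1) j)
  set s := Equiv.swap i (i + 1) with hs
  set r := Equiv.swap j (j + 1) with hr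
  have e2 : opE κ (a⁻¹ j) (a⁻¹ (j + 1)) (opG c κ i f) (k, a)
      = opE κ (s (a⁻¹ j)) (s (a⁻¹ (j + 1))) f (k ∘ s, a * s) +
      c * (if a (i + 1) < a i then
        opE κ i (i + 1) (opE κ (a⁻¹ j) (a⁻¹ (j + 1)) f) (k, a) else 0) := by
    have h := congrArg (fun h : Module.End A (Mod d A) => h f (k, a))
      (opS_opE κ s (s (a⁻¹ j)) (s (a⁻¹ (j + 1))))
    simp only [Module.End.mul_apply, hs, Equiv.swap_apply_self] at h
    change opE κ (s (a⁻¹ j)) (s (a⁻¹ (j + 1))) f (k ∘ s, a * s) = _ at h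
    rw [h, opG, opU]
    have h' := congrArg (fun h : Module.End A (Mod d A) => h f (k, a))
      (show opE κ (a⁻¹ j) (a⁻¹ (j + 1)) * (opE κ i (i + 1) * opD i (i + 1))
        = opD i (i + 1) * (opE κ i (i + 1) * opE κ (a⁻¹ j) (a⁻¹ (j + 1))) by
        rw [← mul_assoc, opE_comm, mul_assoc, opE_opD, ← mul_assoc, opE_opD, mul_assoc])
    simp only [Module.End.mul_apply] at h'
    simp only [LinearMap.add_apply, map_add, LinearMap.smul_apply, map_smul, Pi.add_apply,
      Pi.smul_apply, Module.End.mul_apply, h', smul_eq_mul]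
    rfl
  rw [e1, opG'_apply c κ j (opE κ i (i + 1) f),
    opG'_apply c κ j (opG c κ i f), e2, opG_apply]
  have hinv : (a * s)⁻¹ = s * a⁻¹ := by rw [mul_inv_rev, hs, Equiv.swap_inv]
  simp only [hinv, Equiv.Perm.mul_apply, ← hs, ← hr, mul_assoc]
  have hmon : ∀ x y : ℕ, x ≠ y → ¬ (x = i ∧ y = i + 1) → ¬ (x = i + 1 ∧ y = i) →
      (s x < s y ↔ x < y) := by
    intro x y hxy h1 h2
    simp only [hs, Equiv.swap_apply_def]
    split_ifs <;> omega
  have hmon' : ∀ x y : ℕ, x ≠ y → ¬ (x = j ∧ y = j + 1) → ¬ (x = j + 1 ∧ y = j) →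
      (r x < r y ↔ x < y) := by
    intro x y hxy h1 h2
    simp only [hr, Equiv.swap_apply_def]
    split_ifs <;> omega
  have hne : a⁻¹ j ≠ a⁻¹ (j + 1) := fun h => by simpa using a⁻¹.injective h
  have hne' : a i ≠ a (i + 1) := fun h => by simpa using a.injective h
  by_cases hA : a i = j ∧ a (i + 1) = j + 1
  · obtain ⟨h1, h2⟩ := hA
    have h1' : a⁻¹ j = i := by rw [← h1]; simp
    have h2' : a⁻¹ (j + 1) = i + 1 := by rw [← h2]; simp
    have hc : a * s = r * a := by
      have := Equiv.mul_swap_eq_swap_mul a i (i + 1)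
      rwa [h1, h2] at this
    have s0 : s i = i + 1 := Equiv.swap_apply_left _ _
    have s1 : s (i + 1) = i := Equiv.swap_apply_right _ _
    have r0 : r j = j + 1 := Equiv.swap_apply_left _ _
    have r1 : r (j + 1) = j := Equiv.swap_apply_right _ _
    simp only [h1, h2, h1', h2', s0, s1, r0, r1, ← hc]
    rw [opE_symm κ (i + 1) i, opE_swap κ i (i + 1) f k _ (by omega)]
    simp
  by_cases hB : a i = j + 1 ∧ a (i + 1) = j
  · obtain ⟨h1, h2⟩ := hB
    have h1' : a⁻¹ j = i + 1 := by rw [← h2]; simp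
    have h2' : a⁻¹ (j + 1) = i := by rw [← h1]; simp
    have hc : a * s = r * a := by
      have := Equiv.mul_swap_eq_swap_mul a i (i + 1)
      rwa [h1, h2, Equiv.swap_comm (j + 1)] at this
    have s0 : s i = i + 1 := Equiv.swap_apply_left _ _
    have s1 : s (i + 1) = i := Equiv.swap_apply_right _ _
    have r0 : r j = j + 1 := Equiv.swap_apply_left _ _
    have r1 : r (j + 1) = j := Equiv.swap_apply_right _ _
    simp only [h1, h2, h1', h2', s0, s1, r0, r1, ← hc]
    rw [opE_symm κ (i + 1) i, opE_swap κ i (i + 1) f k _ (by omega)]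
    simp
  have q1 : ¬ (a⁻¹ j = i ∧ a⁻¹ (j + 1) = i + 1) := by
    rintro ⟨h1, h2⟩; exact hA ⟨by rw [← h1]; simp, by rw [← h2]; simp⟩
  have q2 : ¬ (a⁻¹ j = i + 1 ∧ a⁻¹ (j + 1) = i) := by
    rintro ⟨h1, h2⟩; exact hB ⟨by rw [← h2]; simp, by rw [← h1]; simp⟩
  simp only [hmon _ _ hne.symm (by tauto) (by tauto), hmon' _ _ hne'.symm (by tauto) (by tauto)]
  have e3 : opE κ i (i + 1) (opE κ (a⁻¹ j) (a⁻¹ (j + 1)) f) (k, a)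
      = opE κ (a⁻¹ j) (a⁻¹ (j + 1)) (opE κ i (i + 1) f) (k, a) :=
    congrArg (fun h : Module.End A (Mod d A) => h f (k, a))
      (opE_comm κ i (i + 1) (a⁻¹ j) (a⁻¹ (j + 1)))
  rw [e3]
  split_ifs <;> ring

open Classical in
/-- The indicator function of the identity configuration. -/
def vac : Mod d A := fun p => if p.1 = 0 ∧ p.2 = 1 then 1 else 0

theorem vac_apply (k : ℕ → ZMod d) (a : Equiv.Perm ℕ) [Decidable (k = 0 ∧ a = 1)] :
    (vac : Mod d A) (k, a) = if k = 0 ∧ a = 1 then 1 else 0 := by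
  simp only [vac]
  split_ifs <;> rfl

theorem vac_ne (k : ℕ → ZMod d) {a : Equiv.Perm ℕ} (h : a ≠ 1) : (vac : Mod d A) (k, a) = 0 := by
  simp [vac, h]

theorem opE_vac (i j : ℕ) (k : ℕ → ZMod d) {a : Equiv.Perm ℕ} (h : a ≠ 1) :
    opE κ i j (vac : Mod d A) (k, a) = 0 := by
  rw [opE_apply]
  simp [vac_ne _ h]

/-- The coefficient of the identity in the regular representation. -/
def tau : Module.End A (Mod d A) →ₗ[A] A where
  toFun h := h vac (0, 1)
  map_add' _ _ := rfl
  map_smul' _ _ := rfl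

/-- The algebra generated by the operators on the first `n` strands. -/
def opAlg (n : ℕ) : Subalgebra A (Module.End A (Mod d A)) :=
  Algebra.adjoin A ({h | ∃ i, i + 1 < n ∧ h = opG c κ i} ∪ {h | ∃ j s, j < n ∧ h = opT j s})

theorem opG_mem {i n : ℕ} (h : i + 1 < n) : (opG c κ i : Module.End A (Mod d A)) ∈ opAlg c κ n :=
  Algebra.subset_adjoin (Or.inl ⟨i, h, rfl⟩)

theorem opT_mem {j n : ℕ} (h : j < n) (s : ZMod d) :
    (opT j s : Module.End A (Mod d A)) ∈ opAlg c κ n :=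
  Algebra.subset_adjoin (Or.inr ⟨j, s, h, rfl⟩)

theorem opE_mem {i j n : ℕ} (h : i < n) (h' : j < n) :
    (opE κ i j : Module.End A (Mod d A)) ∈ opAlg c κ n :=
  Subalgebra.smul_mem _ (Subalgebra.sum_mem _ fun s _ =>
    Subalgebra.mul_mem _ (opT_mem c κ h s) (opT_mem c κ h' (-s))) _

theorem opAlg_mono {n m : ℕ} (h : n ≤ m) :
    (opAlg c κ n : Subalgebra A (Module.End A (Mod d A))) ≤ opAlg c κ m := by
  refine Algebra.adjoin_le ?_
  rintro _ (⟨i, hi, rfl⟩ | ⟨j, s, hj, rfl⟩)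
  · exact opG_mem c κ (by omega)
  · exact opT_mem c κ (by omega) s

theorem opAlg_commute {n : ℕ} {y : Module.End A (Mod d A)}
    (hG : ∀ i, i + 1 < n → Commute (opG c κ i) y) (hT : ∀ j s, j < n → Commute (opT j s) y)
    {h : Module.End A (Mod d A)} (hh : h ∈ opAlg c κ n) : Commute h y := by
  induction hh using Algebra.adjoin_induction with
  | mem x hx =>
    rcases hx with ⟨i, hi, rfl⟩ | ⟨j, s, hj, rfl⟩
    · exact hG i hi
    · exact hT j s hj
  | algebraMap r => exact Algebra.commutes r y
  | add x y _ _ h1 h2 => exact h1.add_left h2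
  | mul x y _ _ h1 h2 => exact h1.mul_left h2

theorem tau_opG {n : ℕ} {h : Module.End A (Mod d A)} (hh : h ∈ opAlg c κ n) (i : ℕ) :
    tau (h * opG c κ i) = tau (opG c κ i * h) := by
  have h1 : opG c κ i (vac : Mod d A) = opG' c κ i vac := by
    ext ⟨k, a⟩
    rw [opG_apply, opG'_apply]
    congr 1
    · classical
      simp only [vac_apply]
      congr 1
      rw [eq_iff_iff]
      refine and_congr ?_ ?_
      · constructor
        · intro h
          ext l
          simpa using congrFun h (Equiv.swap i (i + 1) l)
        · rintro rfl; rfl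
      · rw [mul_eq_one_iff_eq_inv, mul_eq_one_iff_inv_eq, Equiv.swap_inv, eq_comm]
    · by_cases ha : a = 1
      · subst ha; simp
      · simp [opE_vac _ _ _ _ ha]
  have h2 : ∀ f : Mod d A, opG c κ i f (0, 1) = opG' c κ i f (0, 1) := by
    intro f
    rw [opG_apply, opG'_apply]
    simp
  have hc : Commute h (opG' c κ i) :=
    opAlg_commute c κ (fun l _ => opG_opG' c κ l i) (fun j s _ => opT_opG' c κ j i s) hh
  change h (opG c κ i vac) (0, 1) = opG c κ i (h vac) (0, 1)
  rw [h1, h2]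
  exact congrArg (fun u : Module.End A (Mod d A) => u vac (0, 1)) hc.eq

theorem tau_opT {n : ℕ} {h : Module.End A (Mod d A)} (hh : h ∈ opAlg c κ n) (j : ℕ) (s : ZMod d) :
    tau (h * opT j s) = tau (opT j s * h) := by
  have h1 : opT j s (vac : Mod d A) = opT' j s vac := by
    ext ⟨k, a⟩
    change (vac : Mod d A) (k + Pi.single j s, a) =
      (vac : Mod d A) (k + Pi.single (a⁻¹ j) s, a)
    by_cases ha : a = 1
    · subst ha; simp
    · rw [vac_ne _ ha, vac_ne _ ha]
  have hc : Commute h (opT' j s) :=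
    opAlg_commute c κ (fun l _ => opG_opT' c κ l j s) (fun l r _ => opT_opT' l j r s) hh
  change h (opT j s vac) (0, 1) = opT j s (h vac) (0, 1)
  rw [h1]
  exact congrArg (fun u : Module.End A (Mod d A) => u vac (0, 1)) hc.eq

theorem tau_comm {n : ℕ} {h y : Module.End A (Mod d A)} (hh : h ∈ opAlg c κ n)
    (hy : y ∈ opAlg c κ n) : tau (h * y) = tau (y * h) := by
  induction hy using Algebra.adjoin_induction generalizing h with
  | mem x hx =>
    rcases hx with ⟨i, hi, rfl⟩ | ⟨j, s, hj, rfl⟩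
    · exact tau_opG c κ hh i
    · exact tau_opT c κ hh j s
  | algebraMap r => rw [Algebra.commutes]
  | add x y _ _ h1 h2 => rw [mul_add, add_mul, map_add, map_add, h1 hh, h2 hh]
  | mul x y hx hy h1 h2 =>
    rw [← mul_assoc, h2 (Subalgebra.mul_mem _ hh hx), ← mul_assoc,
      h1 (Subalgebra.mul_mem _ hy hh), mul_assoc]

/-- Elements on `n` strands preserve the functions vanishing on configurations on `n` strands. -/
theorem opAlg_vanish {n : ℕ} {h : Module.End A (Mod d A)} (hh : h ∈ opAlg c κ n) (f : Mod d A)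
    (hf : ∀ k a, (∀ j, n ≤ j → k j = 0) → (∀ j, n ≤ j → a j = j) → f (k, a) = 0) :
    ∀ k a, (∀ j, n ≤ j → k j = 0) → (∀ j, n ≤ j → a j = j) → h f (k, a) = 0 := by
  induction hh using Algebra.adjoin_induction generalizing f with
  | mem x hx =>
    intro k a hk ha
    rcases hx with ⟨i, hi, rfl⟩ | ⟨l, s, hl, rfl⟩
    · rw [opG_apply, opE_apply, hf, Finset.sum_eq_zero]
      · simp
      · intro s _
        refine hf _ _ (fun j hj => ?_) ha
        simp [hk j hj, show j ≠ i by omega, show j ≠ i + 1 by omega]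
      · intro j hj
        simp [Equiv.swap_apply_of_ne_of_ne (show j ≠ i by omega) (show j ≠ i + 1 by omega), hk j hj]
      · intro j hj
        simp [Equiv.swap_apply_of_ne_of_ne (show j ≠ i by omega) (show j ≠ i + 1 by omega), ha j hj]
    · change f (k + Pi.single l s, a) = 0
      refine hf _ _ (fun j hj => ?_) ha
      simp [hk j hj, show j ≠ l by omega]
  | algebraMap r =>
    intro k a hk ha
    rw [Module.algebraMap_end_apply, Pi.smul_apply, hf k a hk ha, smul_zero]
  | add x y _ _ h1 h2 =>
    intro k a hk ha
    rw [LinearMap.add_apply, Pi.add_apply, h1 f hf k a hk ha, h2 f hf k a hk ha, add_zero]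
  | mul x y _ _ h1 h2 =>
    exact h1 (y f) (h2 f hf)

theorem tau_opT_last {n : ℕ} {h : Module.End A (Mod d A)} (hh : h ∈ opAlg c κ n) (s : ZMod d)
    (hs : s ≠ 0) : tau (h * opT n s) = 0 := by
  refine opAlg_vanish c κ hh (opT n s vac) ?_ 0 1 (fun _ _ => rfl) fun _ _ => rfl
  intro k a hk ha
  change (vac : Mod d A) (k + Pi.single n s, a) = 0
  classical
  rw [vac_apply, if_neg]
  rintro ⟨h, -⟩
  have := congrFun h n
  simp [hk n le_rfl] at this
  exact hs this

theorem tau_opG_last {n : ℕ} {h : Module.End A (Mod d A)} (hh : h ∈ opAlg c κ (n + 1))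
    (s : ZMod d) : tau (h * opT (n + 1) s * opG c κ n) = 0 := by
  refine opAlg_vanish c κ hh (opT (n + 1) s (opG c κ n vac)) ?_ 0 1
    (fun _ _ => rfl) fun _ _ => rfl
  intro k a hk ha
  change opG c κ n (vac : Mod d A) (k + Pi.single (n + 1) s, a) = 0
  rw [opG_apply, opE_apply]
  by_cases h1 : a = 1
  · subst h1
    have : (1 : Equiv.Perm ℕ) * Equiv.swap n (n + 1) ≠ 1 := by
      rw [one_mul]; intro h
      have := congrArg (fun e : Equiv.Perm ℕ => e n) h
      simp at this
    rw [vac_ne _ this]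
    simp
  · have h2 : a * Equiv.swap n (n + 1) ≠ 1 := by
      intro h
      have := congrArg (fun e : Equiv.Perm ℕ => e n) h
      simp [ha (n + 1) le_rfl] at this
    simp [vac_ne _ h1, vac_ne _ h2]

theorem opE_opT_swap (i j : ℕ) (s : ZMod d) :
    (opE κ i (i + 1) * opT (Equiv.swap i (i + 1) j) s : Module.End A (Mod d A))
      = opE κ i (i + 1) * opT j s := by
  by_cases hi : j = i
  · subst hi; rw [Equiv.swap_apply_left, opE_opT]
  by_cases hi' : j = i + 1
  · subst hi'; rw [Equiv.swap_apply_right, opE_opT]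
  rw [Equiv.swap_apply_of_ne_of_ne hi hi']

theorem opE_opG_self (i : ℕ) :
    (opG c κ i * opE κ i (i + 1) : Module.End A (Mod d A)) = opE κ i (i + 1) * opG c κ i := by
  rw [opE_opG, Equiv.swap_apply_left, Equiv.swap_apply_right, opE_symm]

theorem opT_opG (i j : ℕ) (s : ZMod d) :
    (opT j s * opG c κ i : Module.End A (Mod d A))
      = opG c κ i * opT (Equiv.swap i (i + 1) j) s := by
  rw [opG_opT, Equiv.swap_apply_self]

theorem opG_commute_opAlg {n i : ℕ} (h : n ≤ i) {y : Module.End A (Mod d A)}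
    (hy : y ∈ opAlg c κ n) : Commute y (opG c κ i) := by
  refine opAlg_commute c κ (fun j hj => opG_far c κ j i (by omega)) (fun j s hj => ?_) hy
  have := opG_opT (A := A) c κ i j s
  rw [Equiv.swap_apply_of_ne_of_ne (by omega) (by omega)] at this
  exact this.symm

theorem opT_commute_opAlg {n i : ℕ} (h : n ≤ i) (s : ZMod d) {y : Module.End A (Mod d A)}
    (hy : y ∈ opAlg c κ n) : Commute y (opT i s) := by
  refine opAlg_commute c κ (fun j hj => ?_) (fun j r hj => opT_comm _ _ _ _) hy
  have := opG_opT (A := A) c κ j i s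
  rw [Equiv.swap_apply_of_ne_of_ne (by omega) (by omega)] at this
  exact this

/-- Jucys--Murphy operators. -/
def opL : ℕ → Module.End A (Mod d A)
  | 0 => 0
  | n + 1 => opG c κ n * opL n * opG c κ n + opE κ n (n + 1) * opG c κ n

theorem opL_mem (n : ℕ) : (opL c κ n : Module.End A (Mod d A)) ∈ opAlg c κ (n + 1) := by
  induction n with
  | zero => exact Subalgebra.zero_mem _
  | succ n ih =>
    have hG : (opG c κ n : Module.End A (Mod d A)) ∈ opAlg c κ (n + 1 + 1) :=
      opG_mem c κ (by omega)
    exact Subalgebra.add_mem _ (Subalgebra.mul_mem _ (Subalgebra.mul_mem _ hG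
      (opAlg_mono c κ (by omega) ih)) hG)
      (Subalgebra.mul_mem _ (opE_mem c κ (by omega) (by omega)) hG)

theorem opT_opL (n j : ℕ) (s : ZMod d) :
    (opT j s * opL c κ n : Module.End A (Mod d A)) = opL c κ n * opT j s := by
  induction n generalizing j with
  | zero => simp [opL]
  | succ n ih =>
    rw [opL, mul_add, add_mul]
    congr 1
    · rw [← mul_assoc, ← mul_assoc, opT_opG, mul_assoc (opG c κ n), ih, mul_assoc, mul_assoc,
        ← opG_opT]
      simp only [mul_assoc]
    · rw [← mul_assoc, opT_opE, mul_assoc, opT_opG, ← mul_assoc, ← opE_opG_self, mul_assoc,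
        opE_opT_swap, ← mul_assoc]

theorem opE_opL (n i j : ℕ) :
    (opE κ i j * opL c κ n : Module.End A (Mod d A)) = opL c κ n * opE κ i j := by
  simp only [opE, mul_smul_comm, smul_mul_assoc, Finset.mul_sum, Finset.sum_mul]
  congr 1
  refine Finset.sum_congr rfl fun r _ => ?_
  rw [mul_assoc, opT_opL, ← mul_assoc, opT_opL, mul_assoc]

section
variable {κ}

theorem opG_opL (hκ : κ * d = 1) (i n : ℕ) (h : i + 1 < n) :
    (opG c κ i * opL c κ n : Module.End A (Mod d A)) = opL c κ n * opG c κ i := by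
  induction n with
  | zero => omega
  | succ n ih =>
    by_cases hi : i + 1 < n
    · have h1 : Commute (opG c κ i) (opG c κ n : Module.End A (Mod d A)) := opG_far c κ i n hi
      have h2 : Commute (opG c κ i) (opE κ n (n + 1) : Module.End A (Mod d A)) := by
        have := opE_opG (A := A) (d := d) c κ n (n + 1) i
        rwa [Equiv.swap_apply_of_ne_of_ne (by omega) (by omega),
          Equiv.swap_apply_of_ne_of_ne (by omega) (by omega)] at this
      exact ((h1.mul_right (ih hi)).mul_right h1).add_right (h2.mul_right h1)
    · obtain rfl : n = i + 1 := by omega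
      have hl : (opL c κ i * opG c κ (i + 1) : Module.End A (Mod d A))
          = opG c κ (i + 1) * opL c κ i := (opG_commute_opAlg c κ le_rfl (opL_mem c κ i)).eq
      have hbr := opG_braid (d := d) (A := A) c hκ i
      have hsq := opG_sq (d := d) (A := A) c hκ i
      have sw : ∀ x y z : ℕ, z ≠ x → z ≠ y → Equiv.swap x y z = z :=
        fun x y z h1 h2 => Equiv.swap_apply_of_ne_of_ne h1 h2
      have be := opE_opG (d := d) (A := A) c κ i (i + 1) (i + 1)
      rw [sw _ _ i (by omega) (by omega), Equiv.swap_apply_left] at be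
      have ah := opE_opG (d := d) (A := A) c κ i (i + 1 + 1) i
      rw [sw _ _ (i + 1 + 1) (by omega) (by omega), Equiv.swap_apply_left] at ah
      have af := opE_opG (d := d) (A := A) c κ (i + 1) (i + 1 + 1) i
      rw [sw _ _ (i + 1 + 1) (by omega) (by omega), Equiv.swap_apply_right] at af
      have fe : (opE κ (i + 1) (i + 1 + 1) * opE κ i (i + 1) : Module.End A (Mod d A))
          = opE κ i (i + 1 + 1) * opE κ (i + 1) (i + 1 + 1) := by
        rw [opE_comm, opE_mul_right]
      rw [opL, opL]
      generalize (opG c κ i : Module.End A (Mod d A)) = a at *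
      generalize (opG c κ (i + 1) : Module.End A (Mod d A)) = b at *
      generalize (opL c κ i : Module.End A (Mod d A)) = l at *
      generalize (opE κ i (i + 1) : Module.End A (Mod d A)) = e at *
      generalize (opE κ (i + 1) (i + 1 + 1) : Module.End A (Mod d A)) = f at *
      generalize (opE κ i (i + 1 + 1) : Module.End A (Mod d A)) = h at *
      have E1 : a * (b * (a * l * a) * b) = b * (a * l * a) * b * a := calc
        _ = (a * b * a) * l * a * b := by simp only [mul_assoc]
        _ = b * a * (b * l) * a * b := by rw [hbr]; simp only [mul_assoc]
        _ = b * a * l * (b * a * b) := by rw [← hl]; simp only [mul_assoc]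
        _ = _ := by rw [← hbr]; simp only [mul_assoc]
      have E2 : b * (e * a) * b = h * a * b * a := calc
        _ = (b * e) * a * b := by simp only [mul_assoc]
        _ = h * (b * a * b) := by rw [be]; simp only [mul_assoc]
        _ = _ := by rw [← hbr]; simp only [mul_assoc]
      have E3 : a * (h * a * b * a) = f * b * a + c • (f * e * a * b * a) := calc
        _ = (a * h) * a * b * a := by simp only [mul_assoc]
        _ = f * (a * a) * b * a := by rw [ah]; simp only [mul_assoc]
        _ = _ := by
          rw [hsq]
          simp only [mul_add, add_mul, mul_one, mul_smul_comm, smul_mul_assoc, mul_assoc]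
      have E4 : h * a * b * a * a = h * a * b + c • (h * f * a * b * a) := calc
        _ = h * a * b * (a * a) := by simp only [mul_assoc]
        _ = h * a * b + c • (h * a * (b * e) * a) := by
          rw [hsq]
          simp only [mul_add, add_mul, mul_one, mul_smul_comm, smul_mul_assoc, mul_assoc]
        _ = h * a * b + c • (h * (a * h) * b * a) := by rw [be]; simp only [mul_assoc]
        _ = _ := by rw [ah]; simp only [mul_assoc]
      have E5 : a * (f * b) = h * a * b := by rw [← mul_assoc, af]
      rw [mul_add b, add_mul _ _ b, E2, mul_add, mul_add, add_mul, add_mul, E1, E3, E4, E5, fe]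
      abel

/-- The Jucys--Murphy operator commutes with everything on the earlier strands. -/
theorem opL_commute (hκ : κ * d = 1) {n : ℕ} {y : Module.End A (Mod d A)} (hy : y ∈ opAlg c κ n) :
    Commute y (opL c κ n) :=
  opAlg_commute c κ (fun i hi => opG_opL c hκ i n hi) (fun j s _ => opT_opL c κ n j s) hy

theorem opG_opL_succ (hκ : κ * d = 1) (n : ℕ) : (opG c κ n * opL c κ (n + 1) : Module.End A (Mod d A))
    = opL c κ n * opG c κ n + c • (opE κ n (n + 1) * opL c κ (n + 1)) + opE κ n (n + 1) := by
  have hsq := opG_sq (d := d) (A := A) c hκ n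
  have hE := opE_idem (d := d) (A := A) hκ n (n + 1)
  have hEG := opE_opG_self (d := d) (A := A) c κ n
  rw [opL]
  generalize (opG c κ n : Module.End A (Mod d A)) = a at *
  generalize (opL c κ n : Module.End A (Mod d A)) = l at *
  generalize (opE κ n (n + 1) : Module.End A (Mod d A)) = e at *
  have e1 : a * (a * l * a) = l * a + c • (e * (a * l * a)) := by
    rw [← mul_assoc, ← mul_assoc, hsq]
    simp only [mul_add, add_mul, one_mul, mul_smul_comm, smul_mul_assoc, mul_assoc]
  have e2 : a * (e * a) = e + c • (e * (e * a)) := by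
    rw [← mul_assoc, hEG, mul_assoc, hsq]
    simp only [mul_add, mul_one, mul_smul_comm]
  rw [mul_add, e1, e2, mul_add, smul_add]
  abel

theorem opL_span (hκ : κ * d = 1) (m : ℕ) : (opL c κ (m + 1) : Module.End A (Mod d A)) ∈
    Submodule.span A {h | ∃ u ∈ opAlg c κ (m + 1), ∃ v ∈ opAlg c κ (m + 1), ∃ s : ZMod d,
      h = u * opT (m + 1) s * opG c κ m * v} := by
  have hE : ∀ m : ℕ, (opE κ m (m + 1) * opG c κ m : Module.End A (Mod d A)) ∈
    Submodule.span A {h | ∃ u ∈ opAlg c κ (m + 1), ∃ v ∈ opAlg c κ (m + 1), ∃ s : ZMod d,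
      h = u * opT (m + 1) s * opG c κ m * v} := by
    intro m
    rw [opE, smul_mul_assoc, Finset.sum_mul]
    refine Submodule.smul_mem _ _ (Submodule.sum_mem _ fun s _ => Submodule.subset_span ?_)
    exact ⟨_, opT_mem c κ (Nat.lt_succ_self m) s, 1, Subalgebra.one_mem _, -s, by rw [mul_one]⟩
  induction m with
  | zero => simpa [opL] using hE 0
  | succ m ih =>
    rw [opL]
    refine Submodule.add_mem _ ?_ (hE (m + 1))
    generalize (opL c κ (m + 1) : Module.End A (Mod d A)) = l at ih
    induction ih using Submodule.span_induction with
    | mem x hx =>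
      obtain ⟨u, hu, v, hv, s, rfl⟩ := hx
      have hu' := (opG_commute_opAlg c κ (le_refl (m + 1)) hu).eq
      have hv' := (opG_commute_opAlg c κ (le_refl (m + 1)) hv).eq
      have hG : (opG c κ m : Module.End A (Mod d A)) ∈ opAlg c κ (m + 1 + 1) :=
        opG_mem c κ (by omega)
      refine Submodule.subset_span ⟨u * opG c κ m,
        Subalgebra.mul_mem _ (opAlg_mono c κ (by omega) hu) hG, opG c κ m * v,
        Subalgebra.mul_mem _ hG (opAlg_mono c κ (by omega) hv), s, ?_⟩
      have hT := opG_opT (A := A) c κ (m + 1) (m + 1) s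
      rw [Equiv.swap_apply_left] at hT
      have hT' := opG_opT (A := A) c κ m (m + 1 + 1) s
      rw [Equiv.swap_apply_of_ne_of_ne (by omega) (by omega)] at hT'
      have hbr : (opG c κ m * opG c κ (m + 1) * opG c κ m : Module.End A (Mod d A))
        = opG c κ (m + 1) * opG c κ m * opG c κ (m + 1) := opG_braid c hκ m
      calc _ = (opG c κ (m + 1) * u) * opT (m + 1) s * opG c κ m * (v * opG c κ (m + 1)) := by
            simp only [mul_assoc]
        _ = u * (opG c κ (m + 1) * opT (m + 1) s) * opG c κ m * opG c κ (m + 1) * v := by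
            rw [← hu', hv']; simp only [mul_assoc]
        _ = u * opT (m + 1 + 1) s * (opG c κ (m + 1) * opG c κ m * opG c κ (m + 1)) * v := by
            rw [hT]; simp only [mul_assoc]
        _ = u * (opT (m + 1 + 1) s * opG c κ m) * opG c κ (m + 1) * opG c κ m * v := by
            rw [← hbr]; simp only [mul_assoc]
        _ = _ := by rw [← hT']; simp only [mul_assoc]
    | zero => simp
    | add x y _ _ h1 h2 => rw [mul_add, add_mul]; exact Submodule.add_mem _ h1 h2
    | smul r x _ h1 =>
      rw [mul_smul_comm, smul_mul_assoc]; exact Submodule.smul_mem _ _ h1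

theorem tau_opT_opL (hκ : κ * d = 1) {n : ℕ} {y : Module.End A (Mod d A)} (hy : y ∈ opAlg c κ n) (s : ZMod d) :
    tau (y * opT n s * opL c κ n) = 0 := by
  cases n with
  | zero => simp [opL]
  | succ n =>
    have hl := opL_span (d := d) c hκ n
    generalize (opL c κ (n + 1) : Module.End A (Mod d A)) = l at hl
    induction hl using Submodule.span_induction with
    | mem x hx =>
      obtain ⟨u, hu, v, hv, r, rfl⟩ := hx
      have hu' := (opT_commute_opAlg c κ le_rfl s hu).eq
      have e1 : y * opT (n + 1) s * (u * opT (n + 1) r * opG c κ n * v)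
        = (y * u * opT (n + 1) (s + r) * opG c κ n) * v := by
        rw [← opT_mul]
        calc _ = y * (opT (n + 1) s * u) * opT (n + 1) r * opG c κ n * v := by
              simp only [mul_assoc]
          _ = _ := by rw [← hu']; simp only [mul_assoc]
      have hm : (y * u * opT (n + 1) (s + r) * opG c κ n : Module.End A (Mod d A))
          ∈ opAlg c κ (n + 1 + 1) :=
        Subalgebra.mul_mem _ (Subalgebra.mul_mem _
          (opAlg_mono c κ (by omega) (Subalgebra.mul_mem _ hy hu)) (opT_mem c κ (by omega) _))
          (opG_mem c κ (by omega))
      rw [e1, tau_comm c κ hm (opAlg_mono c κ (by omega) hv)]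
      rw [← mul_assoc, ← mul_assoc]
      exact tau_opG_last c κ (Subalgebra.mul_mem _ hv (Subalgebra.mul_mem _ hy hu)) _
    | zero => simp
    | add x z _ _ h1 h2 => rw [mul_add, map_add, h1, h2, add_zero]
    | smul r x _ h1 => rw [mul_smul_comm, map_smul, h1, smul_zero]

end

/-- The average of framing operators weighted by the trace parameters. -/
def opX (x : ZMod d → A) (j : ℕ) : Module.End A (Mod d A) := ∑ s : ZMod d, x s • opT j (-s)

variable (w : A) (x : ZMod d → A)

def opP (n : ℕ) : Module.End A (Mod d A) := opX x n + w • opL c κ n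

def opC : ℕ → Module.End A (Mod d A)
  | 0 => 1
  | n + 1 => opC n * opP c κ w x n

theorem opX_mem {i n : ℕ} (h : i < n) : (opX x i : Module.End A (Mod d A)) ∈ opAlg c κ n :=
  Subalgebra.sum_mem _ fun s _ => Subalgebra.smul_mem _ (opT_mem c κ h (-s)) _

theorem opP_mem (n : ℕ) : opP c κ w x n ∈ opAlg c κ (n + 1) :=
  Subalgebra.add_mem _ (opX_mem c κ x (Nat.lt_succ_self n))
    (Subalgebra.smul_mem _ (opL_mem c κ n) _)

theorem opC_mem (n : ℕ) : opC c κ w x n ∈ opAlg c κ n := by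
  induction n with
  | zero => exact Subalgebra.one_mem _
  | succ n ih =>
    exact Subalgebra.mul_mem _ (opAlg_mono c κ (by omega) ih) (opP_mem c κ w x n)

theorem opT_opX (i j : ℕ) (s : ZMod d) : opT i s * opX x j = opX x j * opT i s := by
  simp only [opX, Finset.mul_sum, Finset.sum_mul, mul_smul_comm, smul_mul_assoc]
  refine Finset.sum_congr rfl fun r _ => ?_
  rw [opT_comm]

theorem opG_opX (i j : ℕ) :
    opG c κ i * opX x j = opX x (Equiv.swap i (i + 1) j) * opG c κ i := by
  simp only [opX, Finset.mul_sum, Finset.sum_mul, mul_smul_comm, smul_mul_assoc]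
  refine Finset.sum_congr rfl fun r _ => ?_
  rw [opG_opT]

theorem opE_opX (i j : ℕ) : opE κ i j * opX x i = opE κ i j * opX x j := by
  simp only [opX, Finset.mul_sum, mul_smul_comm]
  refine Finset.sum_congr rfl fun r _ => ?_
  rw [opE_opT]

theorem opX_opL (i n : ℕ) : opX x i * opL c κ n = opL c κ n * opX x i := by
  simp only [opX, Finset.mul_sum, Finset.sum_mul, mul_smul_comm, smul_mul_assoc]
  refine Finset.sum_congr rfl fun r _ => ?_
  rw [opT_opL]

theorem opX_opE (l i j : ℕ) : opX x l * opE κ i j = opE κ i j * opX x l := by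
  simp only [opX, Finset.mul_sum, Finset.sum_mul, mul_smul_comm, smul_mul_assoc]
  refine Finset.sum_congr rfl fun r _ => ?_
  rw [opT_opE]

theorem opT_opP (n j : ℕ) (s : ZMod d) :
    opT j s * opP c κ w x n = opP c κ w x n * opT j s := by
  rw [opP, mul_add, add_mul, opT_opX, mul_smul_comm, smul_mul_assoc, opT_opL]

section
variable {κ}

theorem opP_commute (hκ : κ * d = 1) {n : ℕ} {y : Module.End A (Mod d A)} (hy : y ∈ opAlg c κ n) :
    Commute y (opP c κ w x n) := by
  refine opAlg_commute c κ (fun i hi => ?_) (fun j s _ => opT_opP c κ w x n j s) hy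
  have h := opG_opX (A := A) c κ x i n
  rw [Equiv.swap_apply_of_ne_of_ne (by omega) (by omega)] at h
  have h2 := opG_opL (d := d) c hκ i n hi
  rw [commute_iff_eq, opP, mul_add, add_mul, h, mul_smul_comm, smul_mul_assoc, h2]

theorem opG_opP (hκ : κ * d = 1) (m : ℕ) : opG c κ m * (opP c κ w x m * opP c κ w x (m + 1))
    = opP c κ w x m * opP c κ w x (m + 1) * opG c κ m := by
  have hll : opL c κ m * opL c κ (m + 1) = opL c κ (m + 1) * opL c κ m :=
    (opL_commute (d := d) c hκ (opL_mem c κ m)).eq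
  have hsq := opG_sq (d := d) (A := A) c hκ m
  have hE := opE_idem (d := d) (A := A) hκ m (m + 1)
  have hEG := opE_opG_self (d := d) (A := A) c κ m
  have hEl := opE_opL (d := d) (A := A) c κ m m (m + 1)
  have hX := opG_opX c κ x m m
  rw [Equiv.swap_apply_left] at hX
  have hX' := opG_opX c κ x m (m + 1)
  rw [Equiv.swap_apply_right] at hX'
  have hEX := opE_opX κ x m (m + 1)
  have hXl := opX_opL c κ x m m
  have hXl' := opX_opL c κ x (m + 1) m
  have hXE := opX_opE κ x m m (m + 1)
  have hXE' := opX_opE κ x (m + 1) m (m + 1)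
  have hXX : opX x m * opX x (m + 1) = opX x (m + 1) * opX x m := by
    conv_lhs => rw [opX]
    conv_rhs => enter [2]; rw [opX]
    simp only [Finset.mul_sum, Finset.sum_mul, mul_smul_comm, smul_mul_assoc]
    exact Finset.sum_congr rfl fun r _ => by rw [opT_opX]
  rw [opP, opP]
  rw [opL] at hll ⊢
  generalize (opG c κ m : Module.End A (Mod d A)) = a at *
  generalize (opL c κ m : Module.End A (Mod d A)) = l at *
  generalize (opE κ m (m + 1) : Module.End A (Mod d A)) = e at *
  generalize opX x m = X at *
  generalize opX x (m + 1) = Y at *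
  -- the three homogeneous components
  have A0 : a * (X * Y) = X * Y * a := by
    rw [← mul_assoc, hX, mul_assoc, hX', ← mul_assoc, hXX]
  have A1 : a * (X * (a * l * a + e * a) + l * Y) = (X * (a * l * a + e * a) + l * Y) * a := by
    have B1 : a * (X * (a * l * a)) = Y * l * a + c • (Y * e * a * l * a) := calc
      _ = (a * X) * a * l * a := by simp only [mul_assoc]
      _ = Y * (a * a) * l * a := by rw [hX]; simp only [mul_assoc]
      _ = _ := by
        rw [hsq]; simp only [mul_add, add_mul, mul_one, mul_smul_comm, smul_mul_assoc, mul_assoc]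
    have B2 : a * (X * (e * a)) = Y * e * (a * a) := by
      rw [← mul_assoc, hX, mul_assoc, ← mul_assoc a e, hEG]; simp only [mul_assoc]
    have B3 : X * (a * l * a) * a = X * a * l + c • (X * a * l * e * a) := calc
      _ = X * a * l * (a * a) := by simp only [mul_assoc]
      _ = _ := by
        rw [hsq]; simp only [mul_add, add_mul, mul_one, mul_smul_comm, smul_mul_assoc, mul_assoc]
    have B4 : X * a * l * e * a = Y * e * a * l * a := calc
      _ = X * a * (l * e) * a := by simp only [mul_assoc]
      _ = X * (a * e) * l * a := by rw [← hEl]; simp only [mul_assoc]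
      _ = (X * e) * a * l * a := by rw [hEG]; simp only [mul_assoc]
      _ = _ := by rw [hXE, hEX, ← hXE']
    have B5 : X * (e * a) * a = Y * e * (a * a) := calc
      _ = (X * e) * (a * a) := by simp only [mul_assoc]
      _ = _ := by rw [hXE, hEX, ← hXE']
    have B6 : a * (l * Y) = X * a * l := by rw [← hXl', ← mul_assoc, hX']
    have B7 : l * Y * a = Y * l * a := by rw [hXl']
    rw [mul_add, mul_add, mul_add, add_mul, add_mul, B1, B2, B3, B4, B5, B6, B7]
    abel
  have A2 : a * (l * (a * l * a + e * a)) = l * (a * l * a + e * a) * a := by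
    have C1 : a * (l * (a * l * a + e * a)) = l * a * l + e * l
        + c • (e * (a * l * a * l + e * a * l)) := by
      rw [hll]
      calc _ = (a * a) * l * a * l + (a * e) * a * l := by
            simp only [mul_add, add_mul, mul_assoc]
        _ = (a * a) * l * a * l + e * (a * a) * l := by rw [hEG]; simp only [mul_assoc]
        _ = _ := by
          rw [hsq]
          simp only [mul_add, add_mul, one_mul, mul_one, mul_smul_comm, smul_mul_assoc, mul_assoc,
            smul_add]
          abel
    have C2 : l * (a * l * a + e * a) * a = l * a * l + e * l
        + c • (e * (l * a * l * a + e * l * a)) := by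
      calc _ = l * a * l * (a * a) + (l * e) * (a * a) := by
            simp only [mul_add, add_mul, mul_assoc]
        _ = l * a * l * (1 + c • (e * a)) + e * l * (1 + c • (e * a)) := by rw [hsq, ← hEl]
        _ = l * a * l + e * l + c • (l * a * (l * e) * a + e * (l * e) * a) := by
          simp only [mul_add, add_mul, mul_one, mul_smul_comm, smul_mul_assoc, mul_assoc,
            smul_add]
          abel
        _ = l * a * l + e * l + c • (l * (a * e) * l * a + e * e * l * a) := by
          rw [← hEl]; simp only [mul_assoc]
        _ = l * a * l + e * l + c • ((l * e) * a * l * a + e * e * l * a) := by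
          rw [hEG]; simp only [mul_assoc]
        _ = _ := by rw [← hEl]; simp only [mul_add, mul_assoc]
    rw [C1, C2]
    congr 3
    have h := hll
    rw [mul_add, add_mul] at h
    calc a * l * a * l + e * a * l = l * (a * l * a) + l * (e * a) := h.symm
      _ = l * a * l * a + (l * e) * a := by simp only [mul_assoc]
      _ = _ := by rw [← hEl]
  have expand : (X + w • l) * (Y + w • (a * l * a + e * a))
      = X * Y + w • (X * (a * l * a + e * a) + l * Y)
        + (w * w) • (l * (a * l * a + e * a)) := by
    generalize a * l * a + e * a = l'
    simp only [mul_add, add_mul, mul_smul_comm, smul_mul_assoc, smul_add, smul_smul]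
    abel
  rw [expand, mul_add, mul_add, add_mul, add_mul, mul_smul_comm, mul_smul_comm, smul_mul_assoc,
    smul_mul_assoc, A0, A1, A2]

theorem opC_commute (hκ : κ * d = 1) {n : ℕ} {y : Module.End A (Mod d A)} (hy : y ∈ opAlg c κ n) :
    Commute y (opC c κ w x n) := by
  refine opAlg_commute c κ (fun i hi => ?_) (fun j s _ => ?_) hy
  · clear hy
    induction n with
    | zero => omega
    | succ n ih =>
      by_cases h : i + 1 < n
      · exact (ih h).mul_right
          (opP_commute c w x hκ (opG_mem c κ h))
      · obtain rfl : n = i + 1 := by omega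
        rw [opC, opC, mul_assoc]
        exact (opG_commute_opAlg c κ le_rfl (opC_mem c κ w x i)).symm.mul_right
          (opG_opP c w x hκ i)
  · clear hy
    induction n with
    | zero => exact Commute.one_right _
    | succ n ih =>
      by_cases h : j < n
      · exact (ih h).mul_right (opT_opP c κ w x n j s)
      · exact (opT_commute_opAlg c κ (by omega) s (opC_mem c κ w x n)).symm.mul_right
          (opT_opP c κ w x n j s)

theorem tau_opT_opP (hκ : κ * d = 1) {n : ℕ} {y : Module.End A (Mod d A)} (hy : y ∈ opAlg c κ n) (s : ZMod d) :
    tau (y * opT n s * opP c κ w x n) = x s * tau y := by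
  rw [opP, mul_add, map_add, mul_smul_comm, map_smul, tau_opT_opL c hκ hy, smul_zero, add_zero,
    opX, Finset.mul_sum, map_sum]
  rw [Finset.sum_eq_single s]
  · rw [mul_smul_comm, map_smul, mul_assoc, opT_mul, add_neg_cancel, opT_zero, mul_one, smul_eq_mul]
  · intro r _ hr
    rw [mul_smul_comm, map_smul, mul_assoc, opT_mul, tau_opT_last c κ hy, smul_zero]
    intro h
    exact hr (by rw [← sub_eq_add_neg, sub_eq_zero] at h; exact h.symm)
  · simp

theorem tau_opG_opP (hκ : κ * d = 1) {n : ℕ} {y : Module.End A (Mod d A)} (hy : y ∈ opAlg c κ (n + 1)) :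
    tau (y * opG c κ n * opP c κ w x (n + 1)) = w * κ * tau y := by
  have hX : tau (y * opG c κ n * opX x (n + 1)) = 0 := by
    rw [mul_assoc, opG_opX, Equiv.swap_apply_right, opX, Finset.sum_mul, Finset.mul_sum, map_sum]
    refine Finset.sum_eq_zero fun s _ => ?_
    rw [smul_mul_assoc, mul_smul_comm, map_smul, ← mul_assoc]
    have := tau_opG_last c κ
      (Subalgebra.mul_mem _ hy (opT_mem c κ (Nat.lt_succ_self n) (-s))) (0 : ZMod d)
    rw [opT_zero, mul_one] at this
    rw [this, smul_zero]
  have hE : ∀ u : Module.End A (Mod d A),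
      y * (opE κ n (n + 1) * u) = κ • ∑ s : ZMod d, (y * opT n s) * opT (n + 1) (-s) * u := by
    intro u
    rw [opE, smul_mul_assoc, mul_smul_comm, Finset.sum_mul, Finset.mul_sum]
    simp only [mul_assoc]
  have h1 : tau (y * (opL c κ n * opG c κ n)) = 0 := by
    have := tau_opG_last c κ (Subalgebra.mul_mem _ hy (opL_mem c κ n)) (0 : ZMod d)
    rwa [opT_zero, mul_one, mul_assoc] at this
  have h2 : tau (y * (opE κ n (n + 1) * opL c κ (n + 1))) = 0 := by
    rw [hE, map_smul, map_sum, Finset.sum_eq_zero, smul_zero]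
    intro s _
    exact tau_opT_opL c hκ (Subalgebra.mul_mem _ hy (opT_mem c κ (Nat.lt_succ_self n) s)) (-s)
  have h3 : tau (y * opE κ n (n + 1)) = κ * tau y := by
    have := hE 1
    rw [mul_one] at this
    rw [this, map_smul, map_sum, Finset.sum_eq_single 0]
    · simp [opT_zero]
    · intro s _ hs
      rw [mul_one]
      exact tau_opT_last c κ (Subalgebra.mul_mem _ hy (opT_mem c κ (Nat.lt_succ_self n) s)) (-s)
        (neg_ne_zero.mpr hs)
    · simp
  rw [opP, mul_add, map_add, hX, zero_add, mul_smul_comm, map_smul, mul_assoc,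
    opG_opL_succ c hκ, mul_add, mul_add, map_add, map_add, h1, mul_smul_comm, map_smul, h2, h3]
  simp [mul_assoc]

/-! The functional `h ↦ tau (h * opC n)` on the operators on `n` strands satisfies the rules of
the Markov trace. -/

theorem trace_comm (hκ : κ * d = 1) {n : ℕ} {h y : Module.End A (Mod d A)} (hh : h ∈ opAlg c κ n)
    (hy : y ∈ opAlg c κ n) :
    tau (h * y * opC c κ w x n) = tau (y * h * opC c κ w x n) := by
  have hC := opC_mem c κ w x n
  rw [mul_assoc, tau_comm c κ hh (Subalgebra.mul_mem _ hy hC), mul_assoc, mul_assoc,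
    (opC_commute c w x hκ hh).eq]

theorem trace_framing (hκ : κ * d = 1) {n : ℕ} {h : Module.End A (Mod d A)} (hh : h ∈ opAlg c κ n) (s : ZMod d) :
    tau (h * opT n s * opC c κ w x (n + 1)) = x s * tau (h * opC c κ w x n) := by
  have hC := opC_mem c κ w x n
  rw [← tau_opT_opP c w x hκ (Subalgebra.mul_mem _ hh hC), opC]
  have := (opT_commute_opAlg c κ le_rfl s hC).eq
  rw [mul_assoc h (opC c κ w x n), this]
  simp only [mul_assoc]

theorem trace_markov (hκ : κ * d = 1) {n : ℕ} {h : Module.End A (Mod d A)} (hh : h ∈ opAlg c κ (n + 1)) :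
    tau (h * opG c κ n * opC c κ w x (n + 2)) = w * κ * tau (h * opC c κ w x (n + 1)) := by
  have hC := opC_mem c κ w x (n + 1)
  rw [opC, (opP_commute c w x hκ hC).eq, ← mul_assoc]
  have hm : h * opG c κ n * opP c κ w x (n + 1) ∈ opAlg c κ (n + 2) :=
    Subalgebra.mul_mem _ (Subalgebra.mul_mem _ (opAlg_mono c κ (by omega) hh)
      (opG_mem c κ (by omega))) (opP_mem c κ w x (n + 1))
  rw [tau_comm c κ hm (opAlg_mono c κ (by omega) hC), ← mul_assoc, ← mul_assoc,
    tau_opG_opP c w x hκ (Subalgebra.mul_mem _ hC hh), tau_comm c κ hC hh]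

end

end Model

section Existence

variable (d : ℕ) [NeZero d] (q : ℂ)

abbrev OpEnd : Type := Module.End (Polynomial ℂ) (Mod d (Polynomial ℂ))

theorem C_smul_op (r : ℂ) (u : OpEnd d) : Polynomial.C r • u = r • u := by
  ext f p
  simp

def parC : Polynomial ℂ := Polynomial.C (q - q⁻¹)

def parK : Polynomial ℂ := Polynomial.C (1 / (d : ℂ))

theorem parK_mul : parK d * (d : Polynomial ℂ) = 1 := by
  have hd : (d : ℂ) ≠ 0 := Nat.cast_ne_zero.mpr (NeZero.ne d)
  rw [parK, ← Polynomial.C_eq_natCast, ← Polynomial.C_mul, one_div, inv_mul_cancel₀ hd,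
    Polynomial.C_1]

theorem opG_mul_inv (i : ℕ) : (opG (parC q) (parK d) i *
    (opG (parC q) (parK d) i - parC q • opE (parK d) i (i + 1)) : OpEnd d) = 1 := by
  rw [mul_sub, opG_sq _ (parK_mul d), mul_smul_comm, opE_opG_self, add_sub_cancel_right]

theorem opG_inv_mul (i : ℕ) : ((opG (parC q) (parK d) i - parC q • opE (parK d) i (i + 1)) *
    opG (parC q) (parK d) i : OpEnd d) = 1 := by
  rw [sub_mul, opG_sq _ (parK_mul d), smul_mul_assoc, add_sub_cancel_right]

theorem opT_mul_neg (j : ℕ) (s : ZMod d) : (opT j s * opT j (-s) : OpEnd d) = 1 := by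
  rw [opT_mul, add_neg_cancel, opT_zero]

/-- The action of the generators. -/
def repGen (n : ℕ) : FramedGen n → (OpEnd d)ˣ
  | .sigma i _ => ⟨opG (parC q) (parK d) i,
      opG (parC q) (parK d) i - parC q • opE (parK d) i (i + 1), opG_mul_inv d q i,
      opG_inv_mul d q i⟩
  | .t j => ⟨opT j 1, opT j (-1), opT_mul_neg d j 1, by simpa using opT_mul_neg d j (-1)⟩

theorem repGen_sigma (n i : ℕ) (hi : i + 1 < n) :
    (FreeGroup.lift (repGen d q n) (freeSigma i hi) : OpEnd d) = opG (parC q) (parK d) i := by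
  simp [freeSigma, repGen]

theorem repGen_t (n : ℕ) (j : Fin n) :
    (FreeGroup.lift (repGen d q n) (freeT j) : OpEnd d) = opT j 1 := by
  simp [freeT, repGen]

/-- The regular representation of the modular framed braid group. -/
def repGroup (n : ℕ) : ModularFramedBraidGroup d n →* (OpEnd d)ˣ :=
  PresentedGroup.toGroup (f := repGen d q n) (by
    intro x hx
    have hκ := parK_mul d
    rcases hx with hx | ⟨j, rfl⟩
    · cases hx with
      | braid i j hi hj hij =>
        rw [map_mul, map_inv, mul_inv_eq_one, Units.ext_iff]
        simp only [map_mul, Units.val_mul, repGen_sigma]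
        rcases hij with rfl | rfl
        · exact opG_braid _ hκ i
        · exact (opG_braid _ hκ j).symm
      | far i j hi hj hij =>
        rw [map_mul, map_inv, mul_inv_eq_one, Units.ext_iff]
        simp only [map_mul, Units.val_mul, repGen_sigma]
        rcases hij with h | h
        · exact opG_far _ _ i j h
        · exact (opG_far _ _ j i h).symm
      | framing i j =>
        rw [map_mul, map_inv, mul_inv_eq_one, Units.ext_iff]
        simp only [map_mul, Units.val_mul, repGen_t]
        exact opT_comm _ _ _ _
      | mixed i hi j =>
        rw [map_mul, map_inv, mul_inv_eq_one, Units.ext_iff]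
        simp only [map_mul, Units.val_mul, repGen_t, repGen_sigma]
        rw [opT_opG]
        congr 2
        simp only [strandSwap, Equiv.swap_apply_def, Fin.ext_iff]
        split_ifs <;> rfl
    · rw [map_pow, Units.ext_iff, Units.val_pow_eq_pow_val, repGen_t, opT_pow]
      simp [opT_zero])

/-- The regular representation of the group algebra. -/
def repAlg (n : ℕ) : MonoidAlgebra ℂ (ModularFramedBraidGroup d n) →ₐ[ℂ] OpEnd d :=
  MonoidAlgebra.lift ℂ _ _ ((Units.coeHom _).comp (repGroup d q n))

theorem repAlg_of (n : ℕ) (g : ModularFramedBraidGroup d n) :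
    repAlg d q n (MonoidAlgebra.of ℂ _ g) = repGroup d q n g := by
  simp [repAlg]

theorem repGroup_t (n : ℕ) (j : Fin n) : (repGroup d q n (modT d j) : OpEnd d) = opT j 1 := by
  simp [repGroup, modT, repGen]

theorem repGroup_sigma (n i : ℕ) (hi : i + 1 < n) :
    (repGroup d q n (PresentedGroup.of (.sigma i hi)) : OpEnd d) = opG (parC q) (parK d) i := by
  simp [repGroup, repGen]

theorem sum_Icc_zmod {M : Type*} [AddCommMonoid M] (F : ZMod d → M) :
    ∑ s ∈ Finset.Icc 1 d, F s = ∑ s : ZMod d, F s := by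
  refine Finset.sum_bij (fun s _ => (s : ZMod d)) (fun _ _ => Finset.mem_univ _) ?_ ?_
    (fun _ _ => rfl)
  · intro a ha b hb hab
    rw [Finset.mem_Icc] at ha hb
    rw [ZMod.natCast_eq_natCast_iff] at hab
    have h1 : a ≡ b [ZMOD d] := (Int.natCast_modEq_iff).mpr hab
    obtain ⟨k, hk⟩ := h1.dvd
    have : k < 1 := by
      by_contra h
      have : (d : ℤ) * 1 ≤ d * k := by gcongr; omega
      omega
    have : -1 < k := by
      by_contra h
      have : (d : ℤ) * k ≤ d * (-1) := by gcongr; omega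
      omega
    obtain rfl : k = 0 := by omega
    omega
  · intro b _
    by_cases hb : b = 0
    · exact ⟨d, Finset.mem_Icc.mpr ⟨NeZero.one_le, le_rfl⟩, by simp [hb]⟩
    · refine ⟨b.val, Finset.mem_Icc.mpr ⟨?_, (ZMod.val_lt b).le⟩, by simp⟩
      exact Nat.one_le_iff_ne_zero.mpr ((ZMod.val_ne_zero b).mpr hb)

theorem repAlg_algE (n i : ℕ) (hi : i + 1 < n) :
    repAlg d q n (algE d i hi) = opE (parK d) i (i + 1) := by
  rw [algE, map_smul, map_sum, opE, parK, ← sum_Icc_zmod d]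
  simp only [repAlg_of]
  have h1 : ∀ s : ℕ, ((repGroup d q n (modT d ⟨i, Nat.lt_of_succ_lt hi⟩ ^ s *
      (modT d ⟨i + 1, hi⟩ ^ s)⁻¹) : (OpEnd d)ˣ) : OpEnd d)
      = opT i (s : ZMod d) * opT (i + 1) (-(s : ZMod d)) := by
    intro s
    rw [map_mul, map_inv, map_pow, Units.val_mul, Units.val_pow_eq_pow_val, repGroup_t,
      opT_pow, mul_one]
    congr 1
    refine Units.inv_eq_of_mul_eq_one_right ?_
    rw [map_pow, Units.val_pow_eq_pow_val, repGroup_t, opT_pow, mul_one]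
    exact opT_mul_neg d (i + 1) s
  simp only [h1]
  ext f p
  simp

/-- The regular representation of the Yokonuma--Hecke algebra. -/
def rep (n : ℕ) : YHAlgebra d n q →ₐ[ℂ] OpEnd d :=
  RingQuot.liftAlgHom ℂ ⟨repAlg d q n, by
    rintro _ _ ⟨i, hi⟩
    rw [map_pow, map_add, map_one, map_smul, map_mul, repAlg_algE, algSigma, repAlg_of,
      repGroup_sigma, sq, opG_sq _ (parK_mul d)]
    congr 1
    exact C_smul_op d _ _⟩

theorem rep_toYH (n : ℕ) (a : MonoidAlgebra ℂ (ModularFramedBraidGroup d n)) :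
    rep d q n (toYH d n q a) = repAlg d q n a := by
  simp [rep, toYH]

theorem rep_genG (n i : ℕ) (hi : i + 1 < n) :
    rep d q n (genG d q i hi) = opG (parC q) (parK d) i := by
  rw [genG, rep_toYH, algSigma, repAlg_of, repGroup_sigma]

theorem rep_genT (n : ℕ) (j : Fin n) : rep d q n (genT d q j) = opT j 1 := by
  rw [genT, rep_toYH, repAlg_of, repGroup_t]

theorem rep_incl (n : ℕ) (a : YHAlgebra d n q) :
    rep d q (n + 1) (incl d n q a) = rep d q n a := by
  have : (rep d q (n + 1)).comp (incl d n q) = rep d q n := by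
    refine RingQuot.ringQuot_ext' (S := ℂ) (s := QuadraticRel d n q) _ _ ?_
    refine MonoidAlgebra.algHom_ext (fun g => ?_) (by ext)
    have hg : (repGroup d q (n + 1)).comp (ModularFramedBraidGroup.shift d 0 (by omega))
        = repGroup d q n := by
      refine PresentedGroup.ext fun x => ?_
      cases x <;> simp [repGroup, ModularFramedBraidGroup.shift, shiftGen, repGen]
    have h1 := repAlg_of d q n g
    have h2 := repAlg_of d q (n + 1) (ModularFramedBraidGroup.shift d 0 (by omega) g)
    rw [← hg] at h1
    simp only [MonoidAlgebra.of_apply] at h1 h2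
    simp [incl, rep, h1]
    exact (rep_toYH d q (n + 1) _).trans h2
  exact DFunLike.congr_fun this a

theorem rep_mem (n : ℕ) (a : YHAlgebra d n q) :
    rep d q n a ∈ opAlg (parC q) (parK d) n := by
  obtain ⟨b, rfl⟩ := RingQuot.mkAlgHom_surjective ℂ (QuadraticRel d n q) a
  change rep d q n (toYH d n q b) ∈ _
  rw [rep_toYH]
  have hgrp : ∀ g : ModularFramedBraidGroup d n,
      (repGroup d q n g : OpEnd d) ∈ opAlg (parC q) (parK d) n ∧
      (((repGroup d q n g)⁻¹ : (OpEnd d)ˣ) : OpEnd d) ∈ opAlg (parC q) (parK d) n := by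
    intro g
    have hg : g ∈ Subgroup.closure (Set.range (PresentedGroup.of (rels := {r | FramedRel n r} ∪
        {r | ∃ j : Fin n, r = freeT j ^ d}))) := by
      rw [PresentedGroup.closure_range_of]; trivial
    induction hg using Subgroup.closure_induction with
    | mem x hx =>
      obtain ⟨y, rfl⟩ := hx
      rw [repGroup, PresentedGroup.toGroup.of]
      cases y with
      | sigma i hi =>
        exact ⟨opG_mem _ _ hi, Subalgebra.sub_mem _ (opG_mem _ _ hi)
          (Subalgebra.smul_mem _ (opE_mem _ _ (by omega) hi) _)⟩
      | t j => exact ⟨opT_mem _ _ j.2 _, opT_mem _ _ j.2 _⟩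
    | one => simp [Subalgebra.one_mem]
    | mul x y _ _ h1 h2 =>
      rw [map_mul, mul_inv_rev, Units.val_mul, Units.val_mul]
      exact ⟨Subalgebra.mul_mem _ h1.1 h2.1, Subalgebra.mul_mem _ h2.2 h1.2⟩
    | inv x _ h1 =>
      rw [map_inv, inv_inv]
      exact ⟨h1.2, h1.1⟩
  induction b using MonoidAlgebra.induction_on with
  | of g => rw [repAlg_of]; exact (hgrp g).1
  | add x y h1 h2 => rw [map_add]; exact Subalgebra.add_mem _ h1 h2
  | smul r x h1 =>
    rw [map_smul]
    rw [← C_smul_op]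
    exact Subalgebra.smul_mem _ h1 _

/-- A Markov trace exists for all values of the parameters. -/
theorem exists_isMarkovTrace (x : ZMod d → ℂ) :
    ∃ tr : ∀ n : ℕ, YHAlgebra d n q →ₗ[ℂ] Polynomial ℂ, IsMarkovTrace d q x tr := by
  classical
  let x' : ZMod d → Polynomial ℂ := fun s => if s = 0 then 1 else Polynomial.C (x s)
  let w : Polynomial ℂ := Polynomial.X * (d : Polynomial ℂ)
  let C : ℕ → OpEnd d := opC (parC q) (parK d) w x'
  have hκ := parK_mul d
  have hw : w * parK d = Polynomial.X := by
    simp only [w]; rw [mul_assoc, mul_comm _ (parK d), hκ, mul_one]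
  have hx0 : x' 0 = 1 := by simp [x']
  refine ⟨fun n => (((tau (d := d) (A := Polynomial ℂ)).restrictScalars ℂ) ∘ₗ
    LinearMap.mulRight ℂ (C n)) ∘ₗ (rep d q n).toLinearMap, ?_⟩
  have key : ∀ (n : ℕ) (a : YHAlgebra d n q),
      ((((tau (d := d) (A := Polynomial ℂ)).restrictScalars ℂ) ∘ₗ
      LinearMap.mulRight ℂ (C n)) ∘ₗ (rep d q n).toLinearMap) a = tau (rep d q n a * C n) :=
    fun _ _ => rfl
  have hcompat : ∀ (n : ℕ) (a : YHAlgebra d n q),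
      tau (rep d q n a * C (n + 1)) = tau (rep d q n a * C n) := by
    intro n a
    have := trace_framing (parC q) w x' hκ (rep_mem d q n a) 0
    rwa [opT_zero, mul_one, hx0, one_mul] at this
  refine ⟨fun n a => ?_, fun n a b => ?_, fun n => ?_, fun n a => ?_, fun n a s h1 h2 => ?_⟩
  · rw [key, key, rep_incl, hcompat]
  · rw [key, key, map_mul (rep d q n), map_mul (rep d q n)]
    exact trace_comm (parC q) w x' hκ (rep_mem d q n a) (rep_mem d q n b)
  · rw [key]
    induction n with
    | zero =>
      rw [map_one, one_mul]
      change (vac : Mod d (Polynomial ℂ)) (0, 1) = 1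
      simp [vac]
    | succ n ih =>
      rw [map_one] at ih ⊢
      have := hcompat n 1
      rwa [map_one, ih] at this
  · rw [key, key, map_mul (rep d q (n + 2)), rep_incl, rep_genG]
    have := trace_markov (parC q) w x' hκ (rep_mem d q (n + 1) a)
    rw [hw] at this
    exact this
  · rw [key, key, map_mul (rep d q (n + 1)), rep_incl, map_pow (rep d q (n + 1)), rep_genT, opT_pow, mul_one]
    have hs : (s : ZMod d) ≠ 0 := by
      rw [Ne, ZMod.natCast_eq_zero_iff]
      intro h
      have := Nat.le_of_dvd (by omega) h
      omega
    have := trace_framing (parC q) w x' hκ (rep_mem d q n a) (s : ZMod d)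
    simp only [x', if_neg hs] at this
    exact this

end Existence

/-! ### The specialized trace -/

/-- The specialized trace: the family of linear maps `Y_{d,n}(q) → ℂ[z]` that satisfies the rules
of the Markov trace with the parameters `x₁, …, x_{d-1}` (it is the only one, because the rules
determine it on the inductive basis). -/
def specializedTrace (d : ℕ) [NeZero d] (q : ℂ) (x : ZMod d → ℂ) (n : ℕ) :
    YHAlgebra d n q →ₗ[ℂ] Polynomial ℂ :=
  (exists_isMarkovTrace d q x).choose n

theorem specializedTrace_spec (d : ℕ) [NeZero d] (q : ℂ) (x : ZMod d → ℂ) :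
    IsMarkovTrace d q x (specializedTrace d q x) :=
  (exists_isMarkovTrace d q x).choose_spec

end YokonumaHecke

end

/-!
Write `g` for the last braiding generator of `Y_{d,n+2}(q)` and `t` for its last framing generator.
The words `u t ^ s` and `u g v` with `u, v ∈ Y_{d,n+1}(q)` span `Y_{d,n+2}(q)`: the point is that
`g u g` is again a combination of such words. With `t'` and `g'` the last generators of
`Y_{d,n+1}(q)`, this follows from the quadratic relation for `u = w t' ^ s` and from the braid
relation for `u = v g' w`. Hence a linear functional on `Y_{d,n+2}(q)` is determined by its values
on the words, which the rules of the trace reduce to fewer strands.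

If `x_k = x₁ ^ k` for all `k`, the words give first `tr (a t) = x₁ tr a`, which is the case of a
one-strand braid `β`, and then `tr (α # β) = tr α tr β` by induction on the number of strands of
`β`. Conversely, the connected sum of `t_n ^ a` and `t_1 ^ b` is `t_n ^ (a + b)`, so
multiplicativity of the trace forces `x_{a+b} = x_a x_b`.
-/

namespace YokonumaHecke

section Relations

variable {d n : ℕ} {q : ℂ}

/-- The homomorphism from the modular framed braid group to the multiplicative monoid of the
Yokonuma--Hecke algebra. It transports relations between braids to the algebra. -/
noncomputable def modularToYH (d n : ℕ) (q : ℂ) : ModularFramedBraidGroup d n →* YHAlgebra d n q :=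
  (toYH d n q : _ →* YHAlgebra d n q).comp (MonoidAlgebra.of ℂ _)

theorem modularToYH_sigma (i : ℕ) (hi : i + 1 < n) :
    modularToYH d n q (PresentedGroup.of (.sigma i hi)) = genG d q i hi := rfl

theorem modularToYH_modT (j : Fin n) : modularToYH d n q (modT d j) = genT d q j := rfl

theorem modularToYH_mk_eq_of_framedRel {u v : FreeGroup (FramedGen n)}
    (h : FramedRel n (u * v⁻¹)) :
    modularToYH d n q (PresentedGroup.mk _ u) = modularToYH d n q (PresentedGroup.mk _ v) :=
  congrArg _ (PresentedGroup.mk_eq_mk_of_mul_inv_mem (Or.inl h))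

theorem genG_braid (i : ℕ) (hi : i + 1 + 1 < n) :
    genG d q (i + 1) hi * genG d q i (by omega) * genG d q (i + 1) hi =
      genG d q i (by omega) * genG d q (i + 1) hi * genG d q i (by omega) := by
  have := modularToYH_mk_eq_of_framedRel (d := d) (q := q)
    (FramedRel.braid (i + 1) i hi (by omega) (Or.inr rfl))
  simp only [map_mul] at this
  exact this

theorem commute_genG_genG {i j : ℕ} (hi : i + 1 < n) (hj : j + 1 < n)
    (hij : i + 1 < j ∨ j + 1 < i) : Commute (genG d q i hi) (genG d q j hj) := by
  have := modularToYH_mk_eq_of_framedRel (d := d) (q := q) (FramedRel.far i j hi hj hij)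
  simp only [map_mul] at this
  exact this

theorem commute_genT_genT (i j : Fin n) : Commute (genT d q i) (genT d q j) := by
  have := modularToYH_mk_eq_of_framedRel (d := d) (q := q) (FramedRel.framing i j)
  simp only [map_mul] at this
  exact this

theorem semiconjBy_genG_genT {i : ℕ} (hi : i + 1 < n) (j : Fin n) :
    SemiconjBy (genG d q i hi) (genT d q (strandSwap i hi j)) (genT d q j) := by
  have := modularToYH_mk_eq_of_framedRel (d := d) (q := q) (FramedRel.mixed i hi j)
  simp only [map_mul] at this
  exact this.symm

theorem commute_genG_genT {i : ℕ} (hi : i + 1 < n) {j : Fin n} (hji : (j : ℕ) ≠ i)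
    (hji' : (j : ℕ) ≠ i + 1) : Commute (genG d q i hi) (genT d q j) := by
  have hj : strandSwap i hi j = j :=
    Equiv.swap_apply_of_ne_of_ne (Fin.ne_of_val_ne hji) (Fin.ne_of_val_ne hji')
  have := semiconjBy_genG_genT (d := d) (q := q) hi j
  rwa [hj] at this

theorem modT_pow_card (j : Fin n) : modT d j ^ d = 1 :=
  PresentedGroup.one_of_mem (Or.inr ⟨j, rfl⟩)

theorem genT_pow_card (j : Fin n) : genT d q j ^ d = 1 := by
  rw [← modularToYH_modT, ← map_pow, modT_pow_card, map_one]

/-- The idempotent `e_i` of `Y_{d,n}(q)`, written without inverses by means of `t ^ d = 1`, so that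
it visibly lies in the subalgebra generated by the framings. -/
noncomputable def genE (d : ℕ) {n : ℕ} (q : ℂ) (i : ℕ) (hi : i + 1 < n) : YHAlgebra d n q :=
  (1 / (d : ℂ)) • ∑ s ∈ Finset.Icc 1 d,
    genT d q ⟨i, Nat.lt_of_succ_lt hi⟩ ^ s * genT d q ⟨i + 1, hi⟩ ^ (d - s)

theorem toYH_algE (i : ℕ) (hi : i + 1 < n) : toYH d n q (algE d i hi) = genE d q i hi := by
  rw [genE, algE, map_smul, map_sum]
  congr 1
  refine Finset.sum_congr rfl fun s hs => ?_
  have inv_pow : (modT d (⟨i + 1, hi⟩ : Fin n) ^ s)⁻¹ = modT d ⟨i + 1, hi⟩ ^ (d - s) := by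
    rw [inv_eq_iff_mul_eq_one, ← pow_add, Nat.add_sub_cancel' (Finset.mem_Icc.mp hs).2,
      modT_pow_card]
  change modularToYH d n q _ = _
  rw [inv_pow, map_mul, map_pow, map_pow, modularToYH_modT, modularToYH_modT]

theorem genG_mul_self (i : ℕ) (hi : i + 1 < n) :
    genG d q i hi * genG d q i hi = 1 + (q - q⁻¹) • (genE d q i hi * genG d q i hi) := by
  have := RingQuot.mkAlgHom_rel ℂ (QuadraticRel.quad (d := d) (n := n) (q := q) i hi)
  rw [map_pow, map_add, map_one, map_smul, map_mul] at this
  rw [← sq, ← toYH_algE]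
  exact this

end Relations

section Generation

variable {d n : ℕ} {q : ℂ}

theorem modularToYH_inv_sigma (i : ℕ) (hi : i + 1 < n) :
    modularToYH d n q (PresentedGroup.of (.sigma i hi))⁻¹ =
      genG d q i hi - (q - q⁻¹) • genE d q i hi := by
  have left_inv : (genG d q i hi - (q - q⁻¹) • genE d q i hi) * genG d q i hi = 1 := by
    rw [sub_mul, genG_mul_self, smul_mul_assoc, add_sub_cancel_right]
  have right_inv :
      genG d q i hi * modularToYH d n q (PresentedGroup.of (.sigma i hi))⁻¹ = 1 := by
    rw [← modularToYH_sigma, ← map_mul, mul_inv_cancel, map_one]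
  exact (left_inv_eq_right_inv left_inv right_inv).symm

theorem modularToYH_inv_modT [NeZero d] (j : Fin n) :
    modularToYH d n q (modT d j)⁻¹ = genT d q j ^ (d - 1) := by
  have inv_eq : (modT d j)⁻¹ = modT d j ^ (d - 1) := by
    rw [inv_eq_iff_mul_eq_one, ← pow_succ', Nat.sub_add_cancel NeZero.one_le, modT_pow_card]
  rw [inv_eq, map_pow, modularToYH_modT]

theorem genE_mem {S : Subalgebra ℂ (YHAlgebra d n q)} (hT : ∀ j, genT d q j ∈ S) (i : ℕ)
    (hi : i + 1 < n) : genE d q i hi ∈ S :=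
  S.smul_mem (S.sum_mem fun _ _ => S.mul_mem (S.pow_mem (hT _) _) (S.pow_mem (hT _) _)) _

theorem subalgebra_eq_top_of_generators_mem [NeZero d] {S : Subalgebra ℂ (YHAlgebra d n q)}
    (hG : ∀ i hi, genG d q i hi ∈ S) (hT : ∀ j, genT d q j ∈ S) : S = ⊤ := by
  have modularToYH_mem (g : ModularFramedBraidGroup d n) : modularToYH d n q g ∈ S := by
    have hg : g ∈ Subgroup.closure (Set.range PresentedGroup.of) := by
      rw [PresentedGroup.closure_range_of]; trivial
    induction hg using Subgroup.closure_induction'' with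
    | mem _ h =>
      obtain ⟨⟨i, hi⟩ | j, rfl⟩ := h
      · exact hG i hi
      · exact hT j
    | inv_mem _ h =>
      obtain ⟨⟨i, hi⟩ | j, rfl⟩ := h
      · rw [modularToYH_inv_sigma]
        exact S.sub_mem (hG i hi) (S.smul_mem (genE_mem hT i hi) _)
      · exact (modularToYH_inv_modT (d := d) (q := q) j).symm ▸ S.pow_mem (hT j) _
    | one => rw [map_one]; exact S.one_mem
    | mul g h _ _ hg hh => rw [map_mul]; exact S.mul_mem hg hh
  refine Algebra.eq_top_iff.mpr fun y => ?_
  obtain ⟨b, rfl⟩ := RingQuot.mkAlgHom_surjective ℂ (QuadraticRel d n q) y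
  induction b using MonoidAlgebra.induction_on with
  | of g => exact modularToYH_mem g
  | add b c hb hc => rw [map_add]; exact S.add_mem hb hc
  | smul r b hb => rw [map_smul]; exact S.smul_mem hb r

theorem submodule_eq_top_of_generators_mul_mem [NeZero d] {M : Submodule ℂ (YHAlgebra d n q)}
    (one_mem : 1 ∈ M) (hG : ∀ i hi, ∀ y ∈ M, genG d q i hi * y ∈ M)
    (hT : ∀ j, ∀ y ∈ M, genT d q j * y ∈ M) : M = ⊤ := by
  let S : Subalgebra ℂ (YHAlgebra d n q) :=
    { carrier := {a | ∀ y ∈ M, a * y ∈ M}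
      mul_mem' := fun ha hb y hy => by rw [mul_assoc]; exact ha _ (hb y hy)
      add_mem' := fun ha hb y hy => by rw [add_mul]; exact M.add_mem (ha y hy) (hb y hy)
      algebraMap_mem' := fun c y hy => by rw [← Algebra.smul_def]; exact M.smul_mem c hy }
  have S_eq_top : S = ⊤ := subalgebra_eq_top_of_generators_mem hG hT
  refine Submodule.eq_top_iff'.mpr fun y => ?_
  have hy : y ∈ S := S_eq_top ▸ Algebra.mem_top
  simpa only [mul_one] using hy 1 one_mem

theorem algHom_ext [NeZero d] {R : Type*} [Semiring R] [Algebra ℂ R]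
    {f g : YHAlgebra d n q →ₐ[ℂ] R} (hG : ∀ i hi, f (genG d q i hi) = g (genG d q i hi))
    (hT : ∀ j, f (genT d q j) = g (genT d q j)) : f = g :=
  (AlgHom.equalizer_eq_top).mp (subalgebra_eq_top_of_generators_mem hG hT)

theorem commute_map_of_generators [NeZero d] {R : Type*} [Ring R] [Algebra ℂ R]
    (f : YHAlgebra d n q →ₐ[ℂ] R) {c : R} (hG : ∀ i hi, Commute c (f (genG d q i hi)))
    (hT : ∀ j, Commute c (f (genT d q j))) (y : YHAlgebra d n q) : Commute c (f y) := by
  have centralizer_eq_top : (Subalgebra.centralizer ℂ {c}).comap f = ⊤ :=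
    subalgebra_eq_top_of_generators_mem
      (fun i hi => (Subalgebra.mem_centralizer_iff ℂ).mpr fun _ hc => hc ▸ hG i hi)
      (fun j => (Subalgebra.mem_centralizer_iff ℂ).mpr fun _ hc => hc ▸ hT j)
  have hy : y ∈ (Subalgebra.centralizer ℂ {c}).comap f := centralizer_eq_top ▸ Algebra.mem_top
  exact (Subalgebra.mem_centralizer_iff ℂ).mp hy c rfl

end Generation

section Shift

variable {d n m : ℕ} {q : ℂ}

/-- The homomorphism `Y_{d,n}(q) → Y_{d,m}(q)`, `g_i ↦ g_{r+i}`, `t_j ↦ t_{r+j}`, where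
`r + n ≤ m`. It describes the connected sum in the algebra, and for `r = 0` and `m = n + 1` it is
the natural inclusion `incl`. -/
noncomputable def shiftYH (d : ℕ) {n m : ℕ} (q : ℂ) (r : ℕ) (h : r + n ≤ m) :
    YHAlgebra d n q →ₐ[ℂ] YHAlgebra d m q :=
  RingQuot.liftAlgHom ℂ ⟨(toYH d m q).comp
    (MonoidAlgebra.mapDomainAlgHom ℂ ℂ (ModularFramedBraidGroup.shift d r h)), by
      rintro _ _ ⟨i, hi⟩
      have := RingQuot.mkAlgHom_rel ℂ
        (QuadraticRel.quad (d := d) (n := m) (q := q) (r + i) (by omega))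
      simpa only [toYH, AlgHom.comp_apply, map_pow, map_add, map_one, map_smul, map_mul,
        mapDomain_shift_algSigma, mapDomain_shift_algE] using this⟩

theorem incl_eq_shiftYH : incl d n q = shiftYH d q 0 (by omega) := rfl

theorem shiftYH_modularToYH (r : ℕ) (h : r + n ≤ m) (g : ModularFramedBraidGroup d n) :
    shiftYH d q r h (modularToYH d n q g) =
      modularToYH d m q (ModularFramedBraidGroup.shift d r h g) := by
  simp [shiftYH, modularToYH, toYH]

theorem shiftYH_genG (r : ℕ) (h : r + n ≤ m) (i : ℕ) (hi : i + 1 < n) :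
    shiftYH d q r h (genG d q i hi) = genG d q (r + i) (by omega) := by
  rw [← modularToYH_sigma, shiftYH_modularToYH, ModularFramedBraidGroup.shift,
    PresentedGroup.toGroup.of]
  rfl

theorem shiftYH_genT (r : ℕ) (h : r + n ≤ m) (j : Fin n) :
    shiftYH d q r h (genT d q j) = genT d q ⟨r + j, by omega⟩ := by
  rw [← modularToYH_modT, shiftYH_modularToYH, ModularFramedBraidGroup.shift, modT,
    PresentedGroup.toGroup.of]
  rfl

theorem incl_genG (i : ℕ) (hi : i + 1 < n) :
    incl d n q (genG d q i hi) = genG d q i (by omega) := by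
  simp only [incl_eq_shiftYH, shiftYH_genG, zero_add]

theorem incl_genT (j : Fin n) : incl d n q (genT d q j) = genT d q j.castSucc := by
  simp only [incl_eq_shiftYH, shiftYH_genT, zero_add]
  rfl

theorem shiftYH_self [NeZero d] (y : YHAlgebra d n q) : shiftYH d q 0 (zero_add n).le y = y := by
  suffices shiftYH d q 0 (zero_add n).le = AlgHom.id ℂ (YHAlgebra d n q) from
    DFunLike.congr_fun this y
  refine algHom_ext (fun i hi => ?_) fun j => ?_ <;>
    simp only [shiftYH_genG, shiftYH_genT, zero_add, AlgHom.id_apply, Fin.eta]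

theorem shiftYH_shiftYH [NeZero d] {k r s t : ℕ} (hr : r + n ≤ m) (hs : s + m ≤ k)
    (hst : s + r = t) (y : YHAlgebra d n q) :
    shiftYH d q s hs (shiftYH d q r hr y) = shiftYH d q t (by omega) y := by
  subst hst
  suffices (shiftYH d q s hs).comp (shiftYH d q r hr) = shiftYH d q (s + r) (by omega) from
    DFunLike.congr_fun this y
  refine algHom_ext (fun i hi => ?_) fun j => ?_ <;>
    simp only [AlgHom.comp_apply, shiftYH_genG, shiftYH_genT, add_assoc]

theorem incl_shiftYH [NeZero d] {r : ℕ} (h : r + n ≤ m) (y : YHAlgebra d n q) :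
    incl d m q (shiftYH d q r h y) = shiftYH d q r (by omega) y :=
  shiftYH_shiftYH h _ (zero_add r) y

theorem shiftYH_incl [NeZero d] {r : ℕ} (h : r + (n + 1) ≤ m) (y : YHAlgebra d n q) :
    shiftYH d q r h (incl d n q y) = shiftYH d q r (by omega) y :=
  shiftYH_shiftYH _ h (add_zero r) y

theorem shiftYH_mul_shiftYH_framing [NeZero d] (a : YHAlgebra d (n + 1) q)
    (u : YHAlgebra d (m + 1) q) (s : ℕ) :
    shiftYH d q 0 (by omega) a *
        shiftYH d q n (by omega) (incl d (m + 1) q u * genT d q (Fin.last (m + 1)) ^ s) =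
      incl d (n + m + 1) q (shiftYH d q 0 (by omega) a * shiftYH d q n (by omega) u) *
        genT d q (Fin.last (n + m + 1)) ^ s := by
  rw [map_mul, map_mul, map_pow, incl_shiftYH, incl_shiftYH, shiftYH_incl, shiftYH_genT, mul_assoc]
  rfl

theorem shiftYH_mul_shiftYH_braiding [NeZero d] (a : YHAlgebra d (n + 1) q)
    (u v : YHAlgebra d (m + 1) q) :
    shiftYH d q 0 (by omega) a * shiftYH d q n (by omega)
        (incl d (m + 1) q u * genG d q m (lt_add_one (m + 1)) * incl d (m + 1) q v) =
      incl d (n + m + 1) q (shiftYH d q 0 (by omega) a * shiftYH d q n (by omega) u) *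
        genG d q (n + m) (lt_add_one (n + m + 1)) *
        incl d (n + m + 1) q (shiftYH d q n (by omega) v) := by
  rw [map_mul, map_mul, map_mul, incl_shiftYH, incl_shiftYH, incl_shiftYH, shiftYH_incl,
    shiftYH_incl, shiftYH_genG, mul_assoc, mul_assoc, mul_assoc]

theorem toModular_shift (r : ℕ) (h : r + n ≤ m) (α : FramedBraidGroup n) :
    toModular d m (FramedBraidGroup.shift r h α) =
      ModularFramedBraidGroup.shift d r h (toModular d n α) := by
  suffices (toModular d m).comp (FramedBraidGroup.shift r h) =
      (ModularFramedBraidGroup.shift d r h).comp (toModular d n) from DFunLike.congr_fun this α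
  exact PresentedGroup.ext fun x => by
    simp [toModular, FramedBraidGroup.shift, ModularFramedBraidGroup.shift]

theorem braidToYH_shift (r : ℕ) (h : r + n ≤ m) (α : FramedBraidGroup n) :
    braidToYH d q (FramedBraidGroup.shift r h α) = shiftYH d q r h (braidToYH d q α) := by
  change modularToYH d m q (toModular d m _) = shiftYH d q r h (modularToYH d n q _)
  rw [toModular_shift, shiftYH_modularToYH]

theorem braidToYH_mul (α β : FramedBraidGroup n) :
    braidToYH d q (α * β) = braidToYH d q α * braidToYH d q β := by
  change modularToYH d n q (toModular d n _) = _
  rw [map_mul, map_mul]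
  rfl

theorem braidToYH_connectedSum (α : FramedBraidGroup (n + 1)) (β : FramedBraidGroup (m + 1)) :
    braidToYH d q (connectedSum α β) =
      shiftYH d q 0 (by omega) (braidToYH d q α) * shiftYH d q n (by omega) (braidToYH d q β) := by
  rw [connectedSum, braidToYH_mul, braidToYH_shift, braidToYH_shift]

theorem braidToYH_t_pow (j : Fin n) (s : ℕ) :
    braidToYH d q (PresentedGroup.of (.t j) ^ s : FramedBraidGroup n) = genT d q j ^ s := by
  change modularToYH d n q (toModular d n _) = _
  rw [map_pow, map_pow, toModular, PresentedGroup.toGroup.of]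
  rfl

end Shift

section Spanning

variable {d n : ℕ} {q : ℂ}

theorem semiconjBy_genG_incl_genT_last :
    SemiconjBy (genG d q n (lt_add_one (n + 1))) (incl d (n + 1) q (genT d q (Fin.last n)))
      (genT d q (Fin.last (n + 1))) := by
  have := semiconjBy_genG_genT (d := d) (q := q) (lt_add_one (n + 1)) (Fin.last (n + 1))
  rw [incl_genT]
  convert this
  exact (Equiv.swap_apply_right _ _).symm

theorem semiconjBy_genG_genT_last :
    SemiconjBy (genG d q n (lt_add_one (n + 1))) (genT d q (Fin.last (n + 1)))
      (incl d (n + 1) q (genT d q (Fin.last n))) := by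
  have := semiconjBy_genG_genT (d := d) (q := q) (lt_add_one (n + 1)) (Fin.last n).castSucc
  rw [incl_genT]
  convert this
  exact (Equiv.swap_apply_left _ _).symm

/-- The linear span of the words `u t_{n+2} ^ s` and `u g_{n+1} v` with `u, v ∈ Y_{d,n+1}(q)`. By
`inductiveSpan_eq_top` it is all of `Y_{d,n+2}(q)`. -/
noncomputable def inductiveSpan (d n : ℕ) (q : ℂ) : Submodule ℂ (YHAlgebra d (n + 1 + 1) q) :=
  Submodule.span ℂ {y |
    (∃ u s, incl d (n + 1) q u * genT d q (Fin.last (n + 1)) ^ s = y) ∨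
    ∃ u v, incl d (n + 1) q u * genG d q n (lt_add_one (n + 1)) * incl d (n + 1) q v = y}

theorem framing_mem_inductiveSpan (u : YHAlgebra d (n + 1) q) (s : ℕ) :
    incl d (n + 1) q u * genT d q (Fin.last (n + 1)) ^ s ∈ inductiveSpan d n q :=
  Submodule.subset_span (Or.inl ⟨u, s, rfl⟩)

theorem braiding_mem_inductiveSpan (u v : YHAlgebra d (n + 1) q) :
    incl d (n + 1) q u * genG d q n (lt_add_one (n + 1)) * incl d (n + 1) q v ∈
      inductiveSpan d n q :=
  Submodule.subset_span (Or.inr ⟨u, v, rfl⟩)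

theorem inductiveSpan_le {N : Submodule ℂ (YHAlgebra d (n + 1 + 1) q)}
    (framing : ∀ u s, incl d (n + 1) q u * genT d q (Fin.last (n + 1)) ^ s ∈ N)
    (braiding : ∀ u v,
      incl d (n + 1) q u * genG d q n (lt_add_one (n + 1)) * incl d (n + 1) q v ∈ N) :
    inductiveSpan d n q ≤ N := by
  refine Submodule.span_le.mpr ?_
  rintro _ (⟨u, s, rfl⟩ | ⟨u, v, rfl⟩)
  exacts [framing u s, braiding u v]

theorem one_mem_inductiveSpan : 1 ∈ inductiveSpan d n q := by
  simpa only [map_one, pow_zero, mul_one] using framing_mem_inductiveSpan (d := d) (q := q) 1 0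

theorem genG_mem_inductiveSpan : genG d q n (lt_add_one (n + 1)) ∈ inductiveSpan d n q := by
  simpa only [map_one, one_mul, mul_one] using braiding_mem_inductiveSpan (d := d) (q := q) 1 1

theorem incl_mul_mem_inductiveSpan (w : YHAlgebra d (n + 1) q) :
    ∀ y ∈ inductiveSpan d n q, incl d (n + 1) q w * y ∈ inductiveSpan d n q := by
  refine inductiveSpan_le
    (N := (inductiveSpan d n q).comap (LinearMap.mulLeft ℂ (incl d (n + 1) q w)))
    (fun u s => ?_) fun u v => ?_
  · rw [Submodule.mem_comap, LinearMap.mulLeft_apply, ← mul_assoc, ← map_mul]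
    exact framing_mem_inductiveSpan _ _
  · rw [Submodule.mem_comap, LinearMap.mulLeft_apply, ← mul_assoc, ← mul_assoc, ← map_mul]
    exact braiding_mem_inductiveSpan _ _

/-- The linear map `u ↦ g u g` from `Y_{d,n+1}(q)` to `Y_{d,n+2}(q)`, where `g` is the last braiding
generator. That it takes values in `inductiveSpan` is the main step towards
`inductiveSpan_eq_top`. -/
noncomputable def genGSandwich (d n : ℕ) (q : ℂ) :
    YHAlgebra d (n + 1) q →ₗ[ℂ] YHAlgebra d (n + 1 + 1) q :=
  (LinearMap.mulLeftRight ℂ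
    (genG d q n (lt_add_one (n + 1)), genG d q n (lt_add_one (n + 1)))).comp
    (incl d (n + 1) q).toLinearMap

theorem genGSandwich_apply (u : YHAlgebra d (n + 1) q) :
    genGSandwich d n q u =
      genG d q n (lt_add_one (n + 1)) * incl d (n + 1) q u * genG d q n (lt_add_one (n + 1)) := rfl

variable [NeZero d]

theorem span_genT_pow_eq_top :
    Submodule.span ℂ (Set.range fun s : ℕ => genT d q (0 : Fin 1) ^ s) = ⊤ := by
  have adjoin_eq_top : Algebra.adjoin ℂ {genT d q (0 : Fin 1)} = ⊤ :=
    subalgebra_eq_top_of_generators_mem (fun i hi => by omega) fun j => by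
      rw [Subsingleton.elim j 0]
      exact Algebra.self_mem_adjoin_singleton ℂ _
  rw [← Algebra.top_toSubmodule, ← adjoin_eq_top, Algebra.adjoin_eq_span,
    ← Submonoid.powers_eq_closure]
  rfl

theorem commute_incl_genT_last (u : YHAlgebra d n q) :
    Commute (incl d n q u) (genT d q (Fin.last n)) := by
  refine (commute_map_of_generators (incl d n q) (fun i hi => ?_) (fun j => ?_) u).symm
  · rw [incl_genG]
    exact (commute_genG_genT _ (by rw [Fin.val_last]; omega) (by rw [Fin.val_last]; omega)).symm
  · rw [incl_genT]
    exact commute_genT_genT _ _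

theorem commute_incl_incl_genG (u : YHAlgebra d n q) :
    Commute (incl d (n + 1) q (incl d n q u)) (genG d q n (lt_add_one (n + 1))) := by
  refine (commute_map_of_generators ((incl d (n + 1) q).comp (incl d n q)) (fun i hi => ?_)
    (fun j => ?_) u).symm
  · rw [AlgHom.comp_apply, incl_genG, incl_genG]
    exact commute_genG_genG _ _ (by omega)
  · rw [AlgHom.comp_apply, incl_genT, incl_genT]
    exact commute_genG_genT _ (by simp only [Fin.val_castSucc]; omega)
      (by simp only [Fin.val_castSucc]; omega)

theorem mul_incl_mem_inductiveSpan (w : YHAlgebra d (n + 1) q) :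
    ∀ y ∈ inductiveSpan d n q, y * incl d (n + 1) q w ∈ inductiveSpan d n q := by
  refine inductiveSpan_le
    (N := (inductiveSpan d n q).comap (LinearMap.mulRight ℂ (incl d (n + 1) q w)))
    (fun u s => ?_) fun u v => ?_
  · rw [Submodule.mem_comap, LinearMap.mulRight_apply, mul_assoc,
      ← ((commute_incl_genT_last w).pow_right s).eq, ← mul_assoc, ← map_mul]
    exact framing_mem_inductiveSpan _ _
  · rw [Submodule.mem_comap, LinearMap.mulRight_apply, mul_assoc, ← map_mul]
    exact braiding_mem_inductiveSpan _ _

theorem genT_last_mul_mem_inductiveSpan :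
    ∀ y ∈ inductiveSpan d n q, genT d q (Fin.last (n + 1)) * y ∈ inductiveSpan d n q := by
  refine inductiveSpan_le
    (N := (inductiveSpan d n q).comap (LinearMap.mulLeft ℂ (genT d q (Fin.last (n + 1)))))
    (fun u s => ?_) fun u v => ?_
  · rw [Submodule.mem_comap, LinearMap.mulLeft_apply, ← mul_assoc,
      ← (commute_incl_genT_last u).eq, mul_assoc, ← pow_succ']
    exact framing_mem_inductiveSpan _ _
  · rw [Submodule.mem_comap, LinearMap.mulLeft_apply, ← mul_assoc, ← mul_assoc,
      ← (commute_incl_genT_last u).eq, mul_assoc (incl d (n + 1) q u),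
      ← semiconjBy_genG_incl_genT_last.eq, ← mul_assoc, mul_assoc _ _ (incl d (n + 1) q v),
      ← map_mul]
    exact braiding_mem_inductiveSpan _ _

theorem genT_last_pow_mul_mem_inductiveSpan (s : ℕ) {y : YHAlgebra d (n + 1 + 1) q}
    (hy : y ∈ inductiveSpan d n q) :
    genT d q (Fin.last (n + 1)) ^ s * y ∈ inductiveSpan d n q := by
  induction s with
  | zero => rwa [pow_zero, one_mul]
  | succ s ih =>
    rw [pow_succ', mul_assoc]
    exact genT_last_mul_mem_inductiveSpan _ ih

theorem genG_mul_genG_mem_inductiveSpan :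
    genG d q n (lt_add_one (n + 1)) * genG d q n (lt_add_one (n + 1)) ∈ inductiveSpan d n q := by
  have genT_castSucc : genT d q (⟨n, by omega⟩ : Fin (n + 1 + 1)) =
      incl d (n + 1) q (genT d q (Fin.last n)) := by rw [incl_genT]; rfl
  rw [genG_mul_self, genE, smul_mul_assoc, Finset.sum_mul, genT_castSucc]
  refine add_mem one_mem_inductiveSpan
    (Submodule.smul_mem _ _ (Submodule.smul_mem _ _ (sum_mem fun s _ => ?_)))
  rw [mul_assoc, ← map_pow]
  exact incl_mul_mem_inductiveSpan _ _
    (genT_last_pow_mul_mem_inductiveSpan _ genG_mem_inductiveSpan)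

theorem genGSandwich_framing_mem_inductiveSpan (u : YHAlgebra d n q) (s : ℕ) :
    genGSandwich d n q (incl d n q u * genT d q (Fin.last n) ^ s) ∈ inductiveSpan d n q := by
  rw [genGSandwich_apply, map_mul, map_pow, ← mul_assoc, ← (commute_incl_incl_genG u).eq,
    mul_assoc, mul_assoc, ← mul_assoc (genG d q n _),
    (semiconjBy_genG_incl_genT_last.pow_right s).eq, mul_assoc]
  exact incl_mul_mem_inductiveSpan _ _
    (genT_last_pow_mul_mem_inductiveSpan s genG_mul_genG_mem_inductiveSpan)

theorem genGSandwich_braiding (u v : YHAlgebra d (n + 1) q) :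
    genGSandwich d (n + 1) q
        (incl d (n + 1) q u * genG d q n (lt_add_one (n + 1)) * incl d (n + 1) q v) =
      incl d (n + 1 + 1) q (incl d (n + 1) q u * genG d q n (lt_add_one (n + 1))) *
        genG d q (n + 1) (lt_add_one (n + 1 + 1)) *
        incl d (n + 1 + 1) q (genG d q n (lt_add_one (n + 1)) * incl d (n + 1) q v) := by
  have braid := genG_braid (d := d) (q := q) n (lt_add_one (n + 1 + 1))
  have comm_u := (commute_incl_incl_genG u).eq
  have comm_v := (commute_incl_incl_genG v).eq
  simp only [genGSandwich_apply, map_mul, incl_genG]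
  set g := genG d q (n + 1) (lt_add_one (n + 1 + 1))
  set g' := genG d q n (by omega : n + 1 < n + 1 + 1 + 1)
  set u' := incl d (n + 1 + 1) q (incl d (n + 1) q u)
  set v' := incl d (n + 1 + 1) q (incl d (n + 1) q v)
  calc g * (u' * g' * v') * g = g * u' * g' * (v' * g) := by simp only [mul_assoc]
    _ = u' * (g * g' * g) * v' := by rw [← comm_u, comm_v]; simp only [mul_assoc]
    _ = u' * g' * g * (g' * v') := by rw [braid]; simp only [mul_assoc]

theorem genG_mul_mem_inductiveSpan (h : ∀ u, genGSandwich d n q u ∈ inductiveSpan d n q) :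
    ∀ y ∈ inductiveSpan d n q, genG d q n (lt_add_one (n + 1)) * y ∈ inductiveSpan d n q := by
  refine inductiveSpan_le (N := (inductiveSpan d n q).comap
    (LinearMap.mulLeft ℂ (genG d q n (lt_add_one (n + 1))))) (fun u s => ?_) fun u v => ?_
  · rw [Submodule.mem_comap, LinearMap.mulLeft_apply,
      ((commute_incl_genT_last u).pow_right s).eq, ← mul_assoc,
      (semiconjBy_genG_genT_last.pow_right s).eq, ← map_pow]
    exact braiding_mem_inductiveSpan _ _
  · rw [Submodule.mem_comap, LinearMap.mulLeft_apply, ← mul_assoc, ← mul_assoc]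
    exact mul_incl_mem_inductiveSpan v _ (h u)

theorem inductiveSpan_eq_top_of_genGSandwich_mem
    (h : ∀ u, genGSandwich d n q u ∈ inductiveSpan d n q) : inductiveSpan d n q = ⊤ := by
  refine submodule_eq_top_of_generators_mul_mem one_mem_inductiveSpan (fun i hi => ?_) fun j => ?_
  · obtain hin | rfl := Nat.lt_succ_iff_lt_or_eq.mp (Nat.lt_of_succ_lt_succ hi)
    · rw [← incl_genG i (Nat.succ_lt_succ hin)]
      exact incl_mul_mem_inductiveSpan _
    · exact genG_mul_mem_inductiveSpan h
  · induction j using Fin.lastCases with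
    | last => exact genT_last_mul_mem_inductiveSpan
    | cast j =>
      rw [← incl_genT]
      exact incl_mul_mem_inductiveSpan _

theorem inductiveSpan_eq_top : inductiveSpan d n q = ⊤ := by
  suffices ⊤ ≤ (inductiveSpan d n q).comap (genGSandwich d n q) from
    inductiveSpan_eq_top_of_genGSandwich_mem fun u => this Submodule.mem_top
  induction n with
  | zero =>
    rw [← span_genT_pow_eq_top, Submodule.span_le]
    rintro _ ⟨s, rfl⟩
    have := genGSandwich_framing_mem_inductiveSpan (d := d) (q := q) (n := 0) 1 s
    rwa [map_one, one_mul] at this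
  | succ n ih =>
    rw [← inductiveSpan_eq_top_of_genGSandwich_mem fun u => ih Submodule.mem_top]
    refine inductiveSpan_le (genGSandwich_framing_mem_inductiveSpan · ·) fun u v => ?_
    rw [Submodule.mem_comap, genGSandwich_braiding]
    exact braiding_mem_inductiveSpan _ _

theorem linearMap_ext {E : Type*} [AddCommMonoid E] [Module ℂ E]
    {f g : YHAlgebra d (n + 1 + 1) q →ₗ[ℂ] E}
    (framing : ∀ u s, f (incl d (n + 1) q u * genT d q (Fin.last (n + 1)) ^ s) =
      g (incl d (n + 1) q u * genT d q (Fin.last (n + 1)) ^ s))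
    (braiding : ∀ u v,
      f (incl d (n + 1) q u * genG d q n (lt_add_one (n + 1)) * incl d (n + 1) q v) =
        g (incl d (n + 1) q u * genG d q n (lt_add_one (n + 1)) * incl d (n + 1) q v)) :
    f = g :=
  LinearMap.eqLocus_eq_top.mp
    (top_le_iff.mp (inductiveSpan_eq_top.ge.trans (inductiveSpan_le framing braiding)))

end Spanning

section Trace

variable {d n : ℕ} {q : ℂ} {x : ZMod d → ℂ}
  {tr : ∀ n : ℕ, YHAlgebra d n q →ₗ[ℂ] Polynomial ℂ}

theorem IsMarkovTrace.braiding (h : IsMarkovTrace d q x tr) (u v : YHAlgebra d (n + 1) q) :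
    tr (n + 1 + 1) (incl d (n + 1) q u * genG d q n (lt_add_one (n + 1)) * incl d (n + 1) q v) =
      Polynomial.X * tr (n + 1) (u * v) := by
  rw [h.comm, ← mul_assoc, ← map_mul, h.markov, h.comm]

variable [NeZero d]

theorem IsMarkovTrace.framing_pow (h : IsMarkovTrace d q x tr) (hx : x 0 = 1)
    (a : YHAlgebra d n q) (s : ℕ) :
    tr (n + 1) (incl d n q a * genT d q (Fin.last n) ^ s) = Polynomial.C (x s) * tr n a := by
  rw [pow_eq_pow_mod s (genT_pow_card (Fin.last n)), ← ZMod.natCast_mod s d]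
  have hs : s % d < d := Nat.mod_lt _ (NeZero.pos d)
  generalize s % d = r at hs ⊢
  obtain rfl | hr := Nat.eq_zero_or_pos r
  · rw [pow_zero, mul_one, h.compat, Nat.cast_zero, hx, map_one, one_mul]
  · exact h.framing n a r hr (by omega)

theorem IsMarkovTrace.genT_pow (h : IsMarkovTrace d q x tr) (hx : x 0 = 1) (j : Fin n) (s : ℕ) :
    tr n (genT d q j ^ s) = Polynomial.C (x s) := by
  induction n with
  | zero => exact j.elim0
  | succ n ih =>
    induction j using Fin.lastCases with
    | last => simpa only [map_one, one_mul, h.one, mul_one] using h.framing_pow hx 1 s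
    | cast j => rw [← incl_genT, ← map_pow, h.compat, ih]

theorem IsMarkovTrace.mul_genT_last (h : IsMarkovTrace d q x tr) (hx : ∀ s : ℕ, x s = x 1 ^ s)
    (a : YHAlgebra d (n + 1) q) :
    tr (n + 1) (a * genT d q (Fin.last n)) = Polynomial.C (x 1) * tr (n + 1) a := by
  have hx0 : x 0 = 1 := by simpa using hx 0
  have hx_succ (s : ℕ) : x (s + 1 : ℕ) = x 1 * x s := by rw [hx, hx s, pow_succ']
  suffices (tr (n + 1)).comp (LinearMap.mulRight ℂ (genT d q (Fin.last n))) =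
      (LinearMap.mulLeft ℂ (Polynomial.C (x 1))).comp (tr (n + 1)) from DFunLike.congr_fun this a
  clear a
  induction n with
  | zero =>
    refine LinearMap.ext_on_range span_genT_pow_eq_top fun s => ?_
    change tr 1 (genT d q 0 ^ s * genT d q 0) = Polynomial.C (x 1) * tr 1 (genT d q 0 ^ s)
    rw [← pow_succ, h.genT_pow hx0, h.genT_pow hx0, hx_succ, map_mul]
  | succ n ih =>
    refine linearMap_ext (fun u s => ?_) fun u v => ?_ <;>
      simp only [LinearMap.comp_apply, LinearMap.mulRight_apply, LinearMap.mulLeft_apply]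
    · rw [mul_assoc, ← pow_succ, h.framing_pow hx0, h.framing_pow hx0, hx_succ, map_mul, mul_assoc]
    · have tr_mul_genT (y : YHAlgebra d (n + 1) q) :
          tr (n + 1) (y * genT d q (Fin.last n)) = Polynomial.C (x 1) * tr (n + 1) y :=
        DFunLike.congr_fun ih y
      rw [mul_assoc, (commute_incl_genT_last v).eq, ← mul_assoc, mul_assoc _ (genG d q n _),
        semiconjBy_genG_genT_last.eq, ← mul_assoc, ← map_mul, h.braiding, h.braiding, h.comm,
        ← mul_assoc, tr_mul_genT, h.comm, mul_left_comm]

theorem IsMarkovTrace.mul_genT_last_pow (h : IsMarkovTrace d q x tr)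
    (hx : ∀ s : ℕ, x s = x 1 ^ s) (a : YHAlgebra d (n + 1) q) (s : ℕ) :
    tr (n + 1) (a * genT d q (Fin.last n) ^ s) = tr (n + 1) a * Polynomial.C (x s) := by
  rw [hx]
  induction s with
  | zero => simp
  | succ s ih =>
    rw [pow_succ, ← mul_assoc, h.mul_genT_last hx, ih, pow_succ, map_mul, mul_comm, mul_assoc]

theorem IsMarkovTrace.shiftYH_mul_shiftYH (h : IsMarkovTrace d q x tr)
    (hx : ∀ s : ℕ, x s = x 1 ^ s) {m : ℕ} (a : YHAlgebra d (n + 1) q)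
    (b : YHAlgebra d (m + 1) q) :
    tr (n + m + 1) (shiftYH d q 0 (by omega) a * shiftYH d q n (by omega) b) =
      tr (n + 1) a * tr (m + 1) b := by
  have hx0 : x 0 = 1 := by simpa using hx 0
  suffices (tr (n + m + 1)).comp ((LinearMap.mulLeft ℂ (shiftYH d q 0 (by omega) a)).comp
      (shiftYH d q n (by omega)).toLinearMap) =
      (LinearMap.mulLeft ℂ (tr (n + 1) a)).comp (tr (m + 1)) from DFunLike.congr_fun this b
  clear b
  induction m with
  | zero =>
    refine LinearMap.ext_on_range span_genT_pow_eq_top fun s => ?_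
    simp only [LinearMap.comp_apply, LinearMap.mulLeft_apply, AlgHom.toLinearMap_apply, map_pow,
      shiftYH_genT, h.genT_pow hx0]
    rw [← h.mul_genT_last_pow hx]
    exact congrArg (fun y => tr (n + 1) (y * _)) (shiftYH_self a)
  | succ m ih =>
    have tr_mul (y : YHAlgebra d (m + 1) q) :
        tr (n + m + 1) (shiftYH d q 0 (by omega) a * shiftYH d q n (by omega) y) =
          tr (n + 1) a * tr (m + 1) y := DFunLike.congr_fun ih y
    refine linearMap_ext (fun u s => ?_) fun u v => ?_ <;>
      simp only [LinearMap.comp_apply, LinearMap.mulLeft_apply, AlgHom.toLinearMap_apply]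
    · rw [shiftYH_mul_shiftYH_framing, h.framing_pow hx0]
      refine (h.framing_pow (n := n + m + 1) hx0 _ s).trans ?_
      rw [tr_mul, mul_left_comm]
    · rw [shiftYH_mul_shiftYH_braiding, h.braiding]
      refine (h.braiding (n := n + m) _ _).trans ?_
      rw [mul_assoc, ← map_mul, tr_mul, mul_left_comm]

theorem IsMarkovTrace.map_natCast_add_of_connectedSum (h : IsMarkovTrace d q x tr) (hx : x 0 = 1)
    {m : ℕ} (hmul : ∀ (α : FramedBraidGroup (n + 1)) (β : FramedBraidGroup (m + 1)),
      tr (n + m + 1) (braidToYH d q (connectedSum α β)) =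
        tr (n + 1) (braidToYH d q α) * tr (m + 1) (braidToYH d q β)) (a b : ℕ) :
    x (a + b : ℕ) = x a * x b := by
  have tr_eq := hmul (PresentedGroup.of (.t (Fin.last n)) ^ a) (PresentedGroup.of (.t 0) ^ b)
  have connectedSum_eq : braidToYH d q (connectedSum
      (PresentedGroup.of (.t (Fin.last n)) ^ a : FramedBraidGroup (n + 1))
      (PresentedGroup.of (.t 0) ^ b : FramedBraidGroup (m + 1))) =
      genT d q (⟨n, by omega⟩ : Fin (n + m + 1)) ^ (a + b) := by
    simp only [braidToYH_connectedSum, braidToYH_t_pow, map_pow, shiftYH_genT, Fin.val_last,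
      Fin.val_zero, zero_add, add_zero, pow_add]
  rw [connectedSum_eq, braidToYH_t_pow, braidToYH_t_pow, h.genT_pow hx, h.genT_pow hx,
    h.genT_pow hx, ← map_mul] at tr_eq
  exact Polynomial.C_injective tr_eq

theorem forall_natCast_eq_pow_iff {M : Type*} [Monoid M] {x : ZMod d → M} (hx : x 0 = 1) :
    (∀ k : ℕ, x k = x 1 ^ k) ↔
      x 1 ^ d = 1 ∧ ∀ k : ℕ, 1 ≤ k → k ≤ d - 1 → x k = x 1 ^ k := by
  refine ⟨fun h => ⟨by rw [← h, ZMod.natCast_self, hx], fun k _ _ => h k⟩, ?_⟩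
  rintro ⟨hd, hk⟩ k
  rw [pow_eq_pow_mod k hd, ← ZMod.natCast_mod k d]
  have hlt : k % d < d := Nat.mod_lt _ (NeZero.pos d)
  obtain h0 | hpos := Nat.eq_zero_or_pos (k % d)
  · rw [h0, Nat.cast_zero, hx, pow_zero]
  · exact hk _ hpos (by omega)

end Trace

end YokonumaHecke

open YokonumaHecke in
theorem mainTheorem9_general (d : ℕ) [NeZero d] (q : ℂ) (hq : q ≠ 0) (x : ZMod d → ℂ)
    (hx : x 0 = 1) (tr : ∀ n : ℕ, YHAlgebra d n q →ₗ[ℂ] Polynomial ℂ)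
    (h : IsMarkovTrace d q x tr) (n m : ℕ) :
    (∀ (α : FramedBraidGroup (n + 1)) (β : FramedBraidGroup (m + 1)),
      tr (n + m + 1) (braidToYH d q (connectedSum α β)) =
        tr (n + 1) (braidToYH d q α) * tr (m + 1) (braidToYH d q β)) ↔
      (x 1 ^ d = 1 ∧ ∀ k : ℕ, 1 ≤ k → k ≤ d - 1 → x k = x 1 ^ k) := by
  rw [← forall_natCast_eq_pow_iff hx]
  constructor
  · intro hmul k
    have map_add := h.map_natCast_add_of_connectedSum hx hmul
    induction k with
    | zero => simpa using hx
    | succ k ih => rw [map_add, ih, Nat.cast_one, pow_succ]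
  · intro hpow α β
    rw [braidToYH_connectedSum]
    exact h.shiftYH_mul_shiftYH hpow _ _

theorem mainTheorem9 (d : ℕ) [NeZero d] (q : ℂ) (hq : q ≠ 0) (x : ZMod d → ℂ)
    (hx : YokonumaHecke.IsESystemSolution d x) (n m : ℕ) :
    (∀ (α : YokonumaHecke.FramedBraidGroup (n + 1)) (β : YokonumaHecke.FramedBraidGroup (m + 1)),
      YokonumaHecke.specializedTrace d q x (n + m + 1)
          (YokonumaHecke.braidToYH d q (YokonumaHecke.connectedSum α β)) =
        YokonumaHecke.specializedTrace d q x (n + 1) (YokonumaHecke.braidToYH d q α) *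
          YokonumaHecke.specializedTrace d q x (m + 1) (YokonumaHecke.braidToYH d q β)) ↔
      (x 1 ^ d = 1 ∧ ∀ k : ℕ, 1 ≤ k → k ≤ d - 1 → x k = x 1 ^ k) :=
  mainTheorem9_general d q hq x hx.1 _ (YokonumaHecke.specializedTrace_spec d q x) n m
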